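/- Let $\Bbbk$ be a commutative ring and let $\Lambda'$ be the free associative $\Bbbk$-algebra on generators $h_1,h_2,\dots$, with the conventions $h_0=1$ and $h_n=0$ for $n<0$. For a finite sequence $\alpha=(a_1,\dots,a_r)$ of positive integers put $|\alpha|=a_1+\dots+a_r$, $h_\alpha=h_{a_1}\cdots h_{a_r}$, and let $S_\alpha=S_{a_1}\times\dots\times S_{a_r}\subset S_{|\alpha|}$ be the corresponding parabolic subgroup of the symmetric group. Define a $\Bbbk$-bilinear form on $\Lambda'$ by $$(h_\beta,h_\alpha)=\sum_{c\in S_\beta\backslash S_n/S_\alpha}(-1)^{\ell(c)}\quad\text{if }|\alpha|=|\beta|=n,\qquad (h_\beta,h_\alpha)=0\quad\text{if }|\alpha|\neq|\beta|,$$ where $\ell(c)$ is the minimal length (number of inversions) of an element of the double coset $c$. Let $\mathcal I=\{x\in\Lambda' : (x,y)=0\text{ for all }y\in\Lambda'\}$ be the radical of this form. Then $\mathcal I$ is a two-sided ideal of $\Lambda'$. Let $\Lambda=\Lambda^{-1}=\Lambda'/\mathcal I$ be the algebra of odd symmetric functions, write $h_n$ also for the image of $h_n$ in $\Lambda$, and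 define $e_n\in\Lambda$ for $n\ge 0$ by $e_0=1$ and $$\sum_{j=0}^n(-1)^{j(j+1)/2}e_jh_{n-j}=0\qquad(n\ge1).$$ 1. The $\Bbbk$-algebra $\Lambda$ is presented by the generators $h_1,h_2,\dots$ (with $h_0=1$ and $h_n=0$ for $n<0$) subject to the defining relations, for all integers $a,b$, $$h_ah_b=h_bh_a\quad\text{if }a+b\text{ is even},$$ $$h_ah_b+(-1)^ah_bh_a=(-1)^ah_{a+1}h_{b-1}+h_{b-1}h_{a+1}\quad\text{if }a+b\text{ is odd}.$$ That is, there is an isomorphism of $\Bbbk$-algebras from the algebra with this presentation onto $\Lambda$ which sends $h_n$ to $h_n$ for all $n$. 2. There is a $\Bbbk$-algebra automorphism $\psi_1$ of $\Lambda$ with $\psi_1(h_n)=e_n$ for all $n\ge0$. -/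

import Mathlib

namespace OddSym

/-- The index of the platform containing position `i` (counted from `0`) when platforms of widths
`l = (a₁, …, a_k)` are placed side by side from left to right. -/
def block : List ℕ+ → ℕ → ℕ
  | [], _ => 0
  | a :: l, i => if i < (a : ℕ) then 0 else block l (i - a) + 1

/-- The size `|α| = a₁ + ⋯ + a_k` of a decomposition. -/
def size (l : List ℕ+) : ℕ := (l.map fun a => (a : ℕ)).sum

/-- The parabolic subgroup `S_α = S_{a₁} × ⋯ × S_{a_k}` of the symmetric group on `n` letters
(used for `n = |α|`): the permutations preserving every platform of `α`. -/
def parabolic (n : ℕ) (α : List ℕ+) : Subgroup (Equiv.Perm (Fin n)) where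
  carrier := {σ | ∀ i, block α (σ i) = block α i}
  one_mem' := fun _ => rfl
  mul_mem' := fun {σ τ} hσ hτ i => (hσ (τ i)).trans (hτ i)
  inv_mem' := fun {σ} hσ i => by
    have h := hσ (σ⁻¹ i)
    rw [(Equiv.Perm.eq_inv_iff_eq (f := σ)).mp rfl] at h
    exact h.symm

/-- The length of a permutation: the number of pairs `i < j` with `σ i > σ j`. -/
def permLength {n : ℕ} (σ : Equiv.Perm (Fin n)) : ℕ :=
  (Finset.univ.filter fun p : Fin n × Fin n => p.1 < p.2 ∧ σ p.2 < σ p.1).card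

/-- The set of double cosets `S_β \ S_n / S_α`. -/
abbrev Cosets (n : ℕ) (β α : List ℕ+) : Type :=
  DoubleCoset.Quotient (parabolic n β : Set (Equiv.Perm (Fin n)))
    (parabolic n α : Set (Equiv.Perm (Fin n)))

instance (n : ℕ) (β α : List ℕ+) : Finite (Cosets n β α) :=
  Finite.of_surjective (DoubleCoset.mk (parabolic n β) (parabolic n α)) Quotient.mk_surjective

noncomputable instance (n : ℕ) (β α : List ℕ+) : Fintype (Cosets n β α) := Fintype.ofFinite _

/-- The length of a double coset: the smallest length of one of its elements. -/
noncomputable def cosetLength {n : ℕ} {β α : List ℕ+} (c : Cosets n β α) : ℕ :=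
  sInf {m | ∃ σ, DoubleCoset.mk (parabolic n β) (parabolic n α) σ = c ∧ permLength σ = m}

section Algebra

variable (k : Type*) [CommRing k]

/-- The free associative algebra `Λ'` on generators `h₁, h₂, …`. -/
abbrev Free : Type _ := FreeAlgebra k ℕ+

/-- The elements `h_n` of `Λ'`, with the conventions `h_0 = 1` and `h_n = 0` for `n < 0`. -/
noncomputable def freeH (n : ℤ) : Free k :=
  if hn : 0 < n then FreeAlgebra.ι k (⟨n.toNat, Int.lt_toNat.mpr hn⟩ : ℕ+)
  else if n = 0 then 1 else 0

/-- The value `(h_β, h_α)`: the sum of `q ^ ℓ(c)` over `c ∈ S_β \ S_n / S_α` if `|β| = |α| = n`,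
and zero if `|β| ≠ |α|`. -/
noncomputable def wordForm (q : k) (β α : List ℕ+) : k :=
  if size β = size α then ∑ c : Cosets (size α) β α, q ^ cosetLength c else 0

/-- The bilinear form on `Λ'` with parameter `q`, given by `wordForm` on the basis of words `h_α`. -/
noncomputable def form (q : k) : LinearMap.BilinForm k (Free k) :=
  (FreeAlgebra.basisFreeMonoid k ℕ+).constr k fun β =>
    (FreeAlgebra.basisFreeMonoid k ℕ+).constr k fun α =>
      wordForm k q (FreeMonoid.toList β) (FreeMonoid.toList α)

/-- The radical `𝓘` of the (symmetric) bilinear form. -/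
def radical (q : k) : Set (Free k) := {x | ∀ y, form k q x y = 0}

/-- The algebra `Λ^q = Λ' / 𝓘`, formed as the quotient of `Λ'` by the two-sided ideal spanned by
`𝓘`. -/
abbrev Lam (q : k) : Type _ := (TwoSidedIdeal.span (radical k q)).ringCon.Quotient

/-- The quotient map `Λ' → Λ^q`. -/
noncomputable def toLam (q : k) : Free k →ₐ[k] Lam k q :=
  RingCon.mkₐ k (TwoSidedIdeal.span (radical k q)).ringCon

/-- The odd complete symmetric functions `h_n ∈ Λ = Λ^{-1}`. -/
noncomputable def oddH (n : ℤ) : Lam k (-1) := toLam k (-1) (freeH k n)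

/-- The odd elementary symmetric functions `e_n ∈ Λ = Λ^{-1}`, defined by `e_0 = 1` and
`∑_{j=0}^{n} (-1)^{j(j+1)/2} e_j h_{n-j} = 0` for `n ≥ 1`, solved for `e_n`. -/
noncomputable def oddE : ℕ → Lam k (-1)
  | 0 => 1
  | n + 1 => -((-1) ^ ((n + 1) * (n + 2) / 2) *
      ∑ j : Fin (n + 1), (-1) ^ ((j : ℕ) * (j + 1) / 2) * oddE j * oddH k ((n + 1 : ℕ) - (j : ℕ)))

/-- The recursion for `e_n` in its implicit form. -/
theorem sum_oddE (n : ℕ) (hn : 1 ≤ n) :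
    ∑ j ∈ Finset.range (n + 1),
      (-1) ^ (j * (j + 1) / 2) * oddE k j * oddH k ((n : ℤ) - (j : ℤ)) = 0 := by
  obtain ⟨m, rfl⟩ : ∃ m, n = m + 1 := ⟨n - 1, by omega⟩
  have h0 : oddH k 0 = 1 := by simp [oddH, freeH]
  rw [Finset.sum_range_succ, sub_self, h0, mul_one, oddE, mul_neg, ← mul_assoc, ← pow_add,
    Even.neg_one_pow ⟨_, rfl⟩, one_mul, ← Fin.sum_univ_eq_sum_range
      (fun j => (-1) ^ (j * (j + 1) / 2) * oddE k j * oddH k (((m + 1 : ℕ) : ℤ) - (j : ℤ)))]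
  exact add_neg_cancel _

/-- The defining relations, for all integers `a`, `b`, each written as a difference to be set equal
to zero: `h_a h_b = h_b h_a` if `a + b` is even, and
`h_a h_b + (-1)^a h_b h_a = (-1)^a h_{a+1} h_{b-1} + h_{b-1} h_{a+1}` if `a + b` is odd. -/
inductive Relator : Free k → Prop
  | even (a b : ℤ) (hab : Even (a + b)) :
      Relator (freeH k a * freeH k b - freeH k b * freeH k a)
  | odd (a b : ℤ) (hab : Odd (a + b)) :
      Relator ((freeH k a * freeH k b + a.negOnePow • (freeH k b * freeH k a)) -
        (a.negOnePow • (freeH k (a + 1) * freeH k (b - 1)) + freeH k (b - 1) * freeH k (a + 1)))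

/-- The algebra presented by the generators `h₁, h₂, …` and the relations above: the quotient of the
free algebra by the two-sided ideal that they generate. -/
abbrev Presented : Type _ := (TwoSidedIdeal.span {x : Free k | Relator k x}).ringCon.Quotient

/-- The class of `h_n` in the presented algebra. -/
noncomputable def presentedH (n : ℤ) : Presented k :=
  RingCon.mkₐ k (TwoSidedIdeal.span {x : Free k | Relator k x}).ringCon (freeH k n)

end Algebra

end OddSym

namespace OddSym

/-! The proof introduces operators `skew k a` on the free algebra, defined by a signed Leibniz rule
together with `h_n ↦ h_{n-a}`. They are adjoint to left multiplication by `h_a`. To see this, double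
cosets are identified with matrices of prescribed row and column sums, and the length of a coset
with the number of north-east/south-west pairs of entries (`wordForm_eq_sum_contingency`). Iterated
skewing peels off such a matrix row by row and produces the same sign (`counit_skewList_tupleH`). By
`form_word`, pairing with a word is therefore skewing by its letters followed by the counit, and `x`
is radical exactly when all these values vanish.

The relations lie in the radical because skewing a defining relation gives a combination of defining
relations (`skewQuad_even`, `skewQuad_odd`); the ideal they generate is thus stable under skewing,
and the counit kills it.

Conversely, the relations rewrite every word as a combination of words with weakly decreasing
letters (`OddRelations.wordProd_mem_sortedSpan`), so it suffices that sorted words be independent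
modulo the radical. The convolution inverse of `h`, which is `e_n` up to sign, satisfies `skew 1 e_n
= ± e_{n-1}` and `skew b e_n = 0` for `b ≥ 2`. Products of elementary functions indexed by conjugate
partitions then pair with sorted words by a matrix that is unitriangular up to signs for the
lexicographic order (`counit_skewList_wordE_conj`). Hence the radical equals the ideal of relations,
over any `k`.

For the automorphism, the elementary functions satisfy the same relations: skewing lowers their
relators to relators of smaller degree, so induction puts them in the radical (`relE_mem_radical`).
This yields an endomorphism. Its inverse is assembled from the anti-homomorphism `h_n ↦
(-1)^{n(n+1)/2} h_n`, and both composites are identified by uniqueness of convolution inverses. -/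

theorem negOnePow_eq_ite (n : ℤ) : n.negOnePow = if Even n then 1 else -1 := by
  split_ifs with h
  · exact Int.negOnePow_even n h
  · exact Int.negOnePow_odd n (Int.not_even_iff_odd.mp h)

/-! ### Skewing the quadratic relations -/

section Relations

variable {R S : Type*} [Ring R] [Ring S]

/-- A sequence in a ring satisfying the defining relations of the odd complete symmetric
functions. -/
structure OddRelations (g : ℤ → R) : Prop where
  zero : g 0 = 1
  neg : ∀ n < 0, g n = 0
  even : ∀ a b, Even (a + b) → g a * g b = g b * g a
  odd : ∀ a b, Odd (a + b) → g a * g b + a.negOnePow • (g b * g a) =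
    a.negOnePow • (g (a + 1) * g (b - 1)) + g (b - 1) * g (a + 1)

/-- The `a`-th skewing of the quadratic element `g c * g d`. -/
def skewQuad (g : ℤ → R) (a : ℕ) (c d : ℤ) : R :=
  ∑ p ∈ Finset.HasAntidiagonal.antidiagonal a,
    ((p.2 : ℤ) * (c - p.1)).negOnePow • (g (c - p.1) * g (d - p.2))

theorem skewQuad_eq_sum_range (g : ℤ → R) (a : ℕ) (c d : ℤ) :
    skewQuad g a c d = ∑ i ∈ Finset.range (a + 1),
      (((a : ℤ) - i) * (c - i)).negOnePow • (g (c - i) * g (d - (a - i))) := by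
  rw [skewQuad, Finset.Nat.sum_antidiagonal_eq_sum_range_succ_mk]
  refine Finset.sum_congr rfl fun i hi => ?_
  rw [Nat.cast_sub (Nat.lt_succ_iff.mp (Finset.mem_range.mp hi))]

theorem skewQuad_swap_eq_sum_range (g : ℤ → R) (a : ℕ) (c d : ℤ) :
    skewQuad g a d c = ∑ i ∈ Finset.range (a + 1),
      ((i : ℤ) * (d - (a - i))).negOnePow • (g (d - (a - i)) * g (c - i)) := by
  rw [skewQuad, ← Finset.Nat.sum_antidiagonal_swap,
    Finset.Nat.sum_antidiagonal_eq_sum_range_succ_mk]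
  refine Finset.sum_congr rfl fun i hi => ?_
  simp only [Prod.fst_swap, Prod.snd_swap]
  rw [Nat.cast_sub (Nat.lt_succ_iff.mp (Finset.mem_range.mp hi))]

theorem sum_range_two_mul (f : ℕ → R) (n : ℕ) :
    ∑ i ∈ Finset.range (2 * n), f i = ∑ u ∈ Finset.range n, (f (2 * u) + f (2 * u + 1)) := by
  induction n with
  | zero => simp
  | succ n ih =>
    rw [Nat.mul_succ, Finset.sum_range_succ, Finset.sum_range_succ, ih, Finset.sum_range_succ,
      add_assoc]

/-- For even `a` every term has even total degree, so the two sides agree termwise. For odd `a` the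
terms have odd total degree; consecutive terms `2u` and `2u + 1` are grouped, and each group is one
instance of the odd relation. -/
theorem OddRelations.skewQuad_even {g : ℤ → R} (hg : OddRelations g) (a : ℕ) (c d : ℤ)
    (h : Even (c + d)) : skewQuad g a c d = skewQuad g a d c := by
  rw [skewQuad_eq_sum_range, skewQuad_swap_eq_sum_range]
  rcases Nat.even_or_odd' a with ⟨v, rfl | rfl⟩
  · refine Finset.sum_congr rfl fun i _ => ?_
    rw [hg.even (c - i) (d - ((2 * v : ℕ) - i)) (by
      push_cast
      rw [show c - (i : ℤ) + (d - (2 * v - i)) = c + d - 2 * v by ring]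
      exact h.sub (even_two_mul _))]
    congr 1
    rcases Int.even_or_odd c with hc | hc <;>
    [have hd : Even d := (Int.even_add.mp h).mp hc;
     have hd : ¬ Even d := fun hd =>
      Int.not_even_iff_odd.mpr hc ((Int.even_add.mp h).mpr hd)] <;>
    rcases Int.even_or_odd (i : ℤ) with hi | hi <;>
    simp_all [negOnePow_eq_ite, Int.even_sub, Int.even_mul, ← Int.not_even_iff_odd]
  · rw [show 2 * v + 1 + 1 = 2 * (v + 1) by ring, sum_range_two_mul, sum_range_two_mul]
    refine Finset.sum_congr rfl fun u _ => ?_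
    obtain ⟨p, rfl⟩ : ∃ p, c = p + 2 * u := ⟨c - 2 * u, by ring⟩
    obtain ⟨q, rfl⟩ : ∃ q, d = q + (2 * v + 1 - 2 * u) := ⟨d - (2 * v + 1 - 2 * u), by ring⟩
    have hpq : Odd (q + p) := by
      have := h.sub_odd (odd_two_mul_add_one (v : ℤ))
      rwa [show p + 2 * u + (q + (2 * v + 1 - 2 * u)) - (2 * v + 1) = q + p by ring] at this
    have key := hg.odd q p hpq
    push_cast
    rw [show p + 2 * (u : ℤ) - 2 * u = p by ring,
      show q + (2 * v + 1 - 2 * u) - (2 * (v : ℤ) + 1 - 2 * u) = q by ring,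
      show p + 2 * (u : ℤ) - (2 * u + 1) = p - 1 by ring,
      show q + (2 * v + 1 - 2 * u) - (2 * (v : ℤ) + 1 - (2 * u + 1)) = q + 1 by ring]
    rw [← Int.not_even_iff_odd, Int.even_add] at hpq
    have e1 : Int.negOnePow ((2 * (v : ℤ) + 1 - 2 * u) * p) = - q.negOnePow := by
      rw [← Int.negOnePow_succ, Int.negOnePow_eq_iff]
      simp only [Int.even_sub, Int.even_add, Int.even_mul, even_two, Int.not_even_one]
      tauto
    have e2 : Int.negOnePow ((2 * (v : ℤ) + 1 - (2 * u + 1)) * (p - 1)) = 1 := by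
      refine Int.negOnePow_even _ ?_
      simp only [Int.even_sub, Int.even_add, Int.even_mul, even_two, Int.not_even_one]
      tauto
    have e3 : Int.negOnePow (2 * (u : ℤ) * q) = 1 := by
      refine Int.negOnePow_even _ ?_
      simp only [Int.even_mul, even_two]
      tauto
    have e4 : Int.negOnePow ((2 * (u : ℤ) + 1) * (q + 1)) = - q.negOnePow := by
      rw [← Int.negOnePow_succ, Int.negOnePow_eq_iff]
      simp only [Int.even_sub, Int.even_add, Int.even_mul, even_two, Int.not_even_one]
      tauto
    rw [e1, e2, e3, e4, one_smul, one_smul, Units.neg_smul, Units.neg_smul]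
    linear_combination (norm := abel) -key

/-- The parities trade places: for even `a` each index gives a signed instance of the odd relation,
while for odd `a` all products commute and the signs match up within consecutive pairs of terms. -/
theorem OddRelations.skewQuad_odd {g : ℤ → R} (hg : OddRelations g) (a : ℕ) (c d : ℤ)
    (h : Odd (c + d)) : skewQuad g a c d + c.negOnePow • skewQuad g a d c =
      c.negOnePow • skewQuad g a (c + 1) (d - 1) + skewQuad g a (d - 1) (c + 1) := by
  rw [skewQuad_eq_sum_range g a c, skewQuad_eq_sum_range g a (c + 1),
    skewQuad_swap_eq_sum_range g a c, skewQuad_swap_eq_sum_range g a (c + 1), Finset.smul_sum,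
    Finset.smul_sum, ← Finset.sum_add_distrib, ← Finset.sum_add_distrib]
  rcases Nat.even_or_odd' a with ⟨v, rfl | rfl⟩
  · refine Finset.sum_congr rfl fun i _ => ?_
    obtain ⟨p, rfl⟩ : ∃ p, c = p + i := ⟨c - i, by ring⟩
    obtain ⟨q, rfl⟩ : ∃ q, d = q + (2 * v - i) := ⟨d - (2 * v - i), by ring⟩
    have hpq : Odd (p + q) := by
      have := h.sub_even (even_two_mul (v : ℤ))
      rwa [show p + i + (q + (2 * v - i)) - 2 * v = p + q by ring] at this
    have key := hg.odd p q hpq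
    push_cast
    rw [show p + (i : ℤ) - i = p by ring, show q + (2 * v - i) - (2 * (v : ℤ) - i) = q by ring,
      show p + (i : ℤ) + 1 - i = p + 1 by ring,
      show q + (2 * v - i) - 1 - (2 * (v : ℤ) - i) = q - 1 by ring]
    simp only [smul_smul, ← Int.negOnePow_add]
    have hq : Even q ↔ ¬ Even p := by
      rw [← Int.not_even_iff_odd, Int.even_add] at hpq
      tauto
    have e1 : Int.negOnePow ((2 * (v : ℤ) - i) * p) = (i * p).negOnePow := by
      rw [Int.negOnePow_eq_iff]
      simp only [Int.even_sub, Int.even_mul, even_two]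
      tauto
    have e2 : Int.negOnePow (p + i + i * q) = (i * p + p).negOnePow := by
      rw [Int.negOnePow_eq_iff]
      simp only [Int.even_sub, Int.even_add, Int.even_mul, hq]
      tauto
    have e3 : Int.negOnePow (p + i + (2 * (v : ℤ) - i) * (p + 1)) = (i * p + p).negOnePow := by
      rw [Int.negOnePow_eq_iff]
      simp only [Int.even_sub, Int.even_add, Int.even_mul, even_two, Int.not_even_one]
      tauto
    have e4 : Int.negOnePow (i * (q - 1)) = (i * p).negOnePow := by
      rw [Int.negOnePow_eq_iff]
      simp only [Int.even_sub, Int.even_mul, Int.not_even_one, hq]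
      tauto
    rw [e1, e2, e3, e4, Int.negOnePow_add, mul_smul, mul_smul, ← smul_add, ← smul_add, key]
  · rw [show 2 * v + 1 + 1 = 2 * (v + 1) by ring, sum_range_two_mul, sum_range_two_mul]
    refine Finset.sum_congr rfl fun u _ => ?_
    obtain ⟨p, rfl⟩ : ∃ p, c = p + 2 * u := ⟨c - 2 * u, by ring⟩
    obtain ⟨q, rfl⟩ : ∃ q, d = q + (2 * v + 1 - 2 * u) := ⟨d - (2 * v + 1 - 2 * u), by ring⟩
    have hpq : Even (p + q) := by
      have := h.sub_odd (odd_two_mul_add_one (v : ℤ))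
      rwa [show p + 2 * u + (q + (2 * v + 1 - 2 * u)) - (2 * v + 1) = p + q by ring] at this
    have hq : Even q ↔ Even p := (Int.even_add.mp hpq).symm
    push_cast
    rw [show p + 2 * (u : ℤ) - 2 * u = p by ring,
      show q + (2 * v + 1 - 2 * u) - (2 * (v : ℤ) + 1 - 2 * u) = q by ring,
      show p + 2 * (u : ℤ) - (2 * u + 1) = p - 1 by ring,
      show q + (2 * v + 1 - 2 * u) - (2 * (v : ℤ) + 1 - (2 * u + 1)) = q + 1 by ring,
      show p + 2 * (u : ℤ) + 1 - 2 * u = p + 1 by ring,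
      show p + 2 * (u : ℤ) + 1 - (2 * u + 1) = p by ring,
      show q + (2 * v + 1 - 2 * u) - 1 - (2 * (v : ℤ) + 1 - 2 * u) = q - 1 by ring,
      show q + (2 * v + 1 - 2 * u) - 1 - (2 * (v : ℤ) + 1 - (2 * u + 1)) = q by ring,
      hg.even q p (by rwa [add_comm]), hg.even (q + 1) (p - 1) (by
        rwa [show q + 1 + (p - 1) = p + q by ring]), hg.even (q - 1) (p + 1) (by
        rwa [show q - 1 + (p + 1) = p + q by ring])]
    by_cases hp : Even p <;>
    · simp only [negOnePow_eq_ite, Int.even_sub, Int.even_add, Int.even_mul, hq, hp, even_two,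
        Int.not_even_one]
      simp

end Relations

/-! ### The skewing operators on the free algebra -/

section Operators

variable (k : Type*) [CommRing k]

theorem basisFreeMonoid_ofList (w : List ℕ+) :
    FreeAlgebra.basisFreeMonoid k ℕ+ (FreeMonoid.ofList w) = (w.map (FreeAlgebra.ι k)).prod := by
  simp [FreeAlgebra.basisFreeMonoid, FreeAlgebra.equivMonoidAlgebraFreeMonoid]

theorem freeH_zero : freeH k 0 = 1 := by simp [freeH]

theorem freeH_neg {n : ℤ} (hn : n < 0) : freeH k n = 0 := by
  simp [freeH, hn.le.not_gt, hn.ne]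

theorem freeH_coe (a : ℕ+) : freeH k (a : ℕ) = FreeAlgebra.ι k a := by
  have : (0 : ℤ) < (a : ℕ) := by exact_mod_cast a.pos
  rw [freeH, dif_pos this]
  rfl

theorem exists_pnat_of_pos {n : ℤ} (hn : 0 < n) : ∃ a : ℕ+, ((a : ℕ) : ℤ) = n :=
  ⟨⟨n.toNat, Int.lt_toNat.mpr hn⟩, Int.toNat_of_nonneg hn.le⟩

/-- The parity involution of `Λ'`, which multiplies `h_n` by `(-1) ^ n`. -/
noncomputable def parity : Free k →ₐ[k] Free k :=
  FreeAlgebra.lift k fun a => ((a : ℕ) : ℤ).negOnePow • FreeAlgebra.ι k a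

theorem parity_freeH (n : ℤ) : parity k (freeH k n) = n.negOnePow • freeH k n := by
  rcases lt_trichotomy n 0 with hn | rfl | hn
  · simp [freeH_neg k hn]
  · simp [freeH_zero]
  · obtain ⟨a, rfl⟩ := exists_pnat_of_pos hn
    rw [freeH_coe, parity, FreeAlgebra.lift_ι_apply]

theorem parity_pow_freeH (j : ℕ) (n : ℤ) :
    (parity k ^ j) (freeH k n) = ((j : ℤ) * n).negOnePow • freeH k n := by
  induction j with
  | zero => simp
  | succ j ih =>
    rw [pow_succ, AlgHom.mul_apply, parity_freeH, Units.smul_def, map_zsmul, ← Units.smul_def, ih,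
      smul_smul, ← Int.negOnePow_add]
    congr 2
    push_cast
    ring

/-- The operators `skew`, on words. -/
noncomputable def skewWord : List ℕ+ → ℕ → Free k
  | [], a => if a = 0 then 1 else 0
  | b :: w, a => ∑ p ∈ Finset.HasAntidiagonal.antidiagonal a,
      (parity k ^ p.2) (freeH k ((b : ℕ) - p.1)) * skewWord w p.2

/-- The operator on `Λ'` adjoint to left multiplication by `h_a`. -/
noncomputable def skew (a : ℕ) : Free k →ₗ[k] Free k :=
  (FreeAlgebra.basisFreeMonoid k ℕ+).constr k fun w => skewWord k (FreeMonoid.toList w) a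

theorem skew_word (a : ℕ) (w : List ℕ+) :
    skew k a ((w.map (FreeAlgebra.ι k)).prod) = skewWord k w a := by
  rw [← basisFreeMonoid_ofList, skew, Module.Basis.constr_basis, FreeMonoid.toList_ofList]

theorem skew_one (a : ℕ) : skew k a 1 = if a = 0 then 1 else 0 := by
  simpa [skewWord] using skew_word k a []

theorem skew_ι_mul (a : ℕ) (b : ℕ+) (x : Free k) :
    skew k a (FreeAlgebra.ι k b * x) = ∑ p ∈ Finset.HasAntidiagonal.antidiagonal a,
      (parity k ^ p.2) (freeH k ((b : ℕ) - p.1)) * skew k p.2 x := by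
  have : skew k a ∘ₗ LinearMap.mulLeft k (FreeAlgebra.ι k b) =
      ∑ p ∈ Finset.HasAntidiagonal.antidiagonal a,
        LinearMap.mulLeft k ((parity k ^ p.2) (freeH k ((b : ℕ) - p.1))) ∘ₗ skew k p.2 := by
    refine (FreeAlgebra.basisFreeMonoid k ℕ+).ext fun w => ?_
    obtain ⟨w, rfl⟩ := FreeMonoid.ofList.surjective w
    rw [basisFreeMonoid_ofList]
    simp only [LinearMap.comp_apply, LinearMap.mulLeft_apply, LinearMap.sum_apply, skew_word]
    rw [← List.prod_cons, ← List.map_cons, skew_word, skewWord]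
  simpa using LinearMap.congr_fun this x

theorem skew_ι (a : ℕ) (b : ℕ+) : skew k a (FreeAlgebra.ι k b) = freeH k ((b : ℕ) - a) := by
  rw [← mul_one (FreeAlgebra.ι k b), skew_ι_mul, Finset.sum_eq_single (a, 0)]
  · simp [skew_one]
  · rintro ⟨i, j⟩ hp hne
    have : j ≠ 0 := fun hj => hne (by simp_all)
    simp [skew_one, this]
  · simp

theorem skew_algebraMap (a : ℕ) (r : k) :
    skew k a (algebraMap k (Free k) r) = if a = 0 then algebraMap k (Free k) r else 0 := by
  rw [Algebra.algebraMap_eq_smul_one, map_smul, skew_one, smul_ite, smul_zero]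

/-- The recursion on words builds in this twisted Leibniz rule for a generator on the left. The
extension to products is coassociativity: the triples `(i, j, l)` are regrouped, and the powers of
the parity involution add up. -/
theorem skew_mul (a : ℕ) (x y : Free k) :
    skew k a (x * y) =
      ∑ p ∈ Finset.HasAntidiagonal.antidiagonal a, (parity k ^ p.2) (skew k p.1 x) * skew k p.2 y := by
  induction x using FreeAlgebra.induction generalizing a y with
  | grade0 r =>
    rw [Finset.sum_eq_single (0, a)]
    · rw [skew_algebraMap, if_pos rfl, AlgHom.commutes, ← Algebra.smul_def, ← Algebra.smul_def,
        map_smul]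
    · rintro ⟨i, j⟩ hp hne
      have : i ≠ 0 := fun hj => hne (by simp_all)
      simp [skew_algebraMap, this]
    · simp
  | grade1 b => simp only [skew_ι_mul, skew_ι]
  | mul x x' hx hx' =>
    rw [mul_assoc, hx]
    simp only [hx, hx', map_sum, map_mul, Finset.sum_mul, Finset.mul_sum]
    rw [Finset.sum_sigma', Finset.sum_sigma']
    refine Finset.sum_nbij' (fun q => ⟨(q.1.1 + q.2.1, q.2.2), (q.1.1, q.2.1)⟩)
      (fun q => ⟨(q.2.1, q.2.2 + q.1.2), (q.2.2, q.1.2)⟩) ?_ ?_ ?_ ?_ ?_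
    · rintro ⟨⟨i, j⟩, ⟨l, m⟩⟩ h
      simp only [Finset.mem_sigma, Finset.HasAntidiagonal.mem_antidiagonal] at h ⊢
      exact ⟨by omega, trivial⟩
    · rintro ⟨⟨i, j⟩, ⟨l, m⟩⟩ h
      simp only [Finset.mem_sigma, Finset.HasAntidiagonal.mem_antidiagonal] at h ⊢
      exact ⟨by omega, trivial⟩
    · rintro ⟨⟨i, j⟩, ⟨l, m⟩⟩ h
      simp only [Finset.mem_sigma, Finset.HasAntidiagonal.mem_antidiagonal] at h ⊢
      obtain ⟨rfl, rfl⟩ := h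
      rfl
    · rintro ⟨⟨i, j⟩, ⟨l, m⟩⟩ h
      simp only [Finset.mem_sigma, Finset.HasAntidiagonal.mem_antidiagonal] at h ⊢
      obtain ⟨rfl, rfl⟩ := h
      rfl
    · rintro ⟨⟨i, j⟩, ⟨l, m⟩⟩ h
      simp only [Finset.mem_sigma, Finset.HasAntidiagonal.mem_antidiagonal] at h ⊢
      obtain ⟨rfl, rfl⟩ := h
      rw [add_comm l m, pow_add, AlgHom.mul_apply, mul_assoc]
  | add x x' hx hx' => simp only [add_mul, map_add, hx, hx', Finset.sum_add_distrib]

theorem skew_freeH (a : ℕ) (n : ℤ) : skew k a (freeH k n) = freeH k (n - a) := by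
  rcases lt_trichotomy n 0 with hn | rfl | hn
  · rw [freeH_neg k hn, freeH_neg k (by omega), map_zero]
  · rw [freeH_zero, skew_one]
    split_ifs with h
    · simp [h, freeH_zero]
    · rw [freeH_neg k (by omega)]
  · obtain ⟨b, rfl⟩ := exists_pnat_of_pos hn
    rw [freeH_coe, skew_ι]

theorem skew_freeH_mul_freeH (a : ℕ) (c d : ℤ) :
    skew k a (freeH k c * freeH k d) = skewQuad (freeH k) a c d := by
  rw [skew_mul, skewQuad]
  refine Finset.sum_congr rfl fun p _ => ?_
  rw [skew_freeH, skew_freeH, parity_pow_freeH, smul_mul_assoc]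

end Operators

end OddSym

namespace OddSym

/-! ### Symmetries of the defining relations -/

section Relations

variable {R S : Type*} [Ring R] [Ring S]

theorem OddRelations.map {g : ℤ → R} (hg : OddRelations g) (f : R →+* S) :
    OddRelations fun n => f (g n) where
  zero := by rw [hg.zero, map_one]
  neg n hn := by rw [hg.neg n hn, map_zero]
  even a b h := by rw [← map_mul, hg.even a b h, map_mul]
  odd a b h := by
    have := congrArg f (hg.odd a b h)
    simpa only [map_add, map_mul, Units.smul_def, map_zsmul] using this

/-- Reversing all products and multiplying by `(-1)^a` turns the odd relation back into itself. -/
theorem OddRelations.unop {g : ℤ → Rᵐᵒᵖ} (hg : OddRelations g) :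
    OddRelations fun n => (g n).unop where
  zero := by rw [hg.zero, MulOpposite.unop_one]
  neg n hn := by rw [hg.neg n hn, MulOpposite.unop_zero]
  even a b h := by rw [← MulOpposite.unop_mul, ← hg.even a b h, MulOpposite.unop_mul]
  odd a b h := by
    have := congrArg (fun x => a.negOnePow • x.unop) (hg.odd a b h)
    simp only [MulOpposite.unop_add, MulOpposite.unop_smul, MulOpposite.unop_mul, smul_add,
      smul_smul, ← Int.negOnePow_add, Int.negOnePow_even _ ⟨a, rfl⟩, one_smul] at this
    rw [add_comm, this, add_comm]

theorem OddRelations.op {g : ℤ → R} (hg : OddRelations g) :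
    OddRelations fun n => MulOpposite.op (g n) := by
  refine OddRelations.unop (R := Rᵐᵒᵖ) (g := fun n => MulOpposite.op (MulOpposite.op (g n))) ?_
  exact hg.map (RingEquiv.opOp R).toRingHom

/-- The sign `(-1) ^ (n (n + 1) / 2)`. -/
def triSign (n : ℤ) : ℤˣ := (n * (n + 1) / 2).negOnePow

theorem triSign_succ (n : ℤ) : triSign (n + 1) = (n + 1).negOnePow * triSign n := by
  rw [triSign, triSign, ← Int.negOnePow_add, show (n + 1) * (n + 1 + 1) = n * (n + 1) + (n + 1) * 2
    by ring, Int.add_mul_ediv_right _ _ two_ne_zero, add_comm]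

theorem triSign_zero : triSign 0 = 1 := rfl

theorem triSign_mul_self (n : ℤ) : triSign n * triSign n = 1 := by
  rw [triSign, ← Int.negOnePow_add, Int.negOnePow_even _ ⟨_, rfl⟩]

theorem triSign_natCast (n : ℕ) : ((triSign n : ℤˣ) : ℤ) = (-1) ^ (n * (n + 1) / 2) := by
  rw [triSign, ← Int.coe_negOnePow_natCast]
  push_cast
  rfl

/-- Multiplying the `n`-th term by `(-1) ^ (n (n + 1) / 2)` preserves the relations. -/
theorem OddRelations.triSign_smul {g : ℤ → R} (hg : OddRelations g) :
    OddRelations fun n => triSign n • g n where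
  zero := by rw [hg.zero, triSign_zero, one_smul]
  neg n hn := by rw [hg.neg n hn, smul_zero]
  even a b h := by
    rw [smul_mul_smul_comm, smul_mul_smul_comm, hg.even a b h, mul_comm]
  odd a b h := by
    -- Raising `a` contributes `(-1)^{a+1}` and lowering `b` contributes `(-1)^b`; these agree
    -- because `a + b` is odd.
    have e : triSign (a + 1) * triSign (b - 1) = triSign a * triSign b := by
      have hb := triSign_succ (b - 1)
      rw [sub_add_cancel] at hb
      rw [triSign_succ, hb, mul_left_comm (triSign a), ← mul_assoc]
      congr 2
      rw [Int.negOnePow_eq_iff]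
      rw [← Int.not_even_iff_odd, Int.even_add] at h
      simp only [Int.even_sub, Int.even_add, Int.not_even_one]
      tauto
    simp only [smul_mul_smul_comm, e, mul_comm (triSign b), mul_comm (triSign (b - 1))]
    rw [smul_comm a.negOnePow, smul_comm a.negOnePow, ← smul_add, ← smul_add, hg.odd a b h]

end Relations

/-! ### The ideal of relations is stable under skewing -/

section Ideal

variable (k : Type*) [CommRing k]

/-- The two-sided ideal generated by the defining relations. -/
noncomputable def relIdeal : TwoSidedIdeal (Free k) :=
  TwoSidedIdeal.span {x : Free k | Relator k x}

variable {k}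

theorem mkₐ_eq_zero_iff (I : TwoSidedIdeal (Free k)) (x : Free k) :
    RingCon.mkₐ k I.ringCon x = 0 ↔ x ∈ I := by
  rw [TwoSidedIdeal.mem_iff, ← RingCon.eq]
  rfl

theorem oddRelations_mk_of_relIdeal_le {I : TwoSidedIdeal (Free k)} (h : relIdeal k ≤ I) :
    OddRelations fun n => RingCon.mkₐ k I.ringCon (freeH k n) where
  zero := by rw [freeH_zero, map_one]
  neg n hn := by rw [freeH_neg k hn, map_zero]
  even a b hab := by
    rw [← map_mul, ← map_mul, ← sub_eq_zero, ← map_sub, mkₐ_eq_zero_iff]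
    exact h (TwoSidedIdeal.subset_span (Relator.even a b hab))
  odd a b hab := by
    have := h (TwoSidedIdeal.subset_span (Relator.odd a b hab))
    rw [← mkₐ_eq_zero_iff, map_sub, sub_eq_zero] at this
    simpa only [map_add, map_mul, Units.smul_def, map_zsmul] using this

theorem relIdeal_le_ker {R : Type*} [Ring R] [Algebra k R] (f : Free k →ₐ[k] R)
    (h : OddRelations fun n => f (freeH k n)) {x : Free k} (hx : x ∈ relIdeal k) : f x = 0 := by
  have : relIdeal k ≤ TwoSidedIdeal.ker f := by
    refine TwoSidedIdeal.span_le.mpr ?_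
    rintro _ (⟨a, b, hab⟩ | ⟨a, b, hab⟩)
    · rw [SetLike.mem_coe, TwoSidedIdeal.mem_ker, map_sub, map_mul, map_mul, h.even a b hab,
        sub_self]
    · rw [SetLike.mem_coe, TwoSidedIdeal.mem_ker, map_sub, sub_eq_zero]
      simpa only [map_add, map_mul, Units.smul_def, map_zsmul] using h.odd a b hab
  exact (TwoSidedIdeal.mem_ker f).mp (this hx)

/-- Both kinds of relation are homogeneous in degree `a + b`, so the involution only scales them. -/
theorem parity_mem_relIdeal {x : Free k} (hx : x ∈ relIdeal k) : parity k x ∈ relIdeal k := by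
  have h := oddRelations_mk_of_relIdeal_le (le_refl (relIdeal k))
  rw [← mkₐ_eq_zero_iff]
  refine relIdeal_le_ker ((RingCon.mkₐ k (relIdeal k).ringCon).comp (parity k)) ?_ hx
  simp only [AlgHom.comp_apply, parity_freeH, Units.smul_def, map_zsmul]
  simp only [← Units.smul_def]
  refine ⟨by simp [h.zero], fun n hn => by rw [h.neg n hn, smul_zero], fun a b hab => ?_,
    fun a b hab => ?_⟩
  · rw [smul_mul_smul_comm, smul_mul_smul_comm, h.even a b hab, mul_comm]
  · simp only [smul_mul_smul_comm, ← Int.negOnePow_add]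
    rw [add_comm b a, show a + 1 + (b - 1) = a + b by ring, show b - 1 + (a + 1) = a + b by ring,
      smul_comm a.negOnePow, smul_comm a.negOnePow, ← smul_add, ← smul_add, h.odd a b hab]

theorem parity_pow_mem_relIdeal {x : Free k} (hx : x ∈ relIdeal k) (j : ℕ) :
    (parity k ^ j) x ∈ relIdeal k := by
  induction j with
  | zero => simpa using hx
  | succ j ih =>
    rw [pow_succ', AlgHom.mul_apply]
    exact parity_mem_relIdeal ih

theorem mk_skewQuad (I : TwoSidedIdeal (Free k)) (a : ℕ) (c d : ℤ) :
    RingCon.mkₐ k I.ringCon (skewQuad (freeH k) a c d) =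
      skewQuad (fun n => RingCon.mkₐ k I.ringCon (freeH k n)) a c d := by
  simp only [skewQuad, map_sum, Units.smul_def, map_zsmul, map_mul]

theorem skew_mem_relIdeal {x : Free k} (hx : x ∈ relIdeal k) (a : ℕ) :
    skew k a x ∈ relIdeal k := by
  -- The elements all of whose skewings stay in the ideal form a two-sided ideal by the Leibniz
  -- rule; stability under the parity involution handles right multiplication. Only the generators
  -- then need checking.
  let J : TwoSidedIdeal (Free k) := TwoSidedIdeal.mk' {x | x ∈ relIdeal k ∧ ∀ a, skew k a x ∈ relIdeal k}
    ⟨TwoSidedIdeal.zero_mem _, fun a => by rw [map_zero]; exact TwoSidedIdeal.zero_mem _⟩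
    (fun hx hy => ⟨add_mem hx.1 hy.1, fun a => by rw [map_add]; exact add_mem (hx.2 a) (hy.2 a)⟩)
    (fun hx => ⟨neg_mem hx.1, fun a => by rw [map_neg]; exact neg_mem (hx.2 a)⟩)
    (fun hy => ⟨TwoSidedIdeal.mul_mem_left _ _ _ hy.1, fun a => by
      rw [skew_mul]
      exact sum_mem fun p _ => TwoSidedIdeal.mul_mem_left _ _ _ (hy.2 _)⟩)
    (fun hx => ⟨TwoSidedIdeal.mul_mem_right _ _ _ hx.1, fun a => by
      rw [skew_mul]
      exact sum_mem fun p _ => TwoSidedIdeal.mul_mem_right _ _ _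
        (parity_pow_mem_relIdeal (hx.2 _) _)⟩)
  have h := oddRelations_mk_of_relIdeal_le (le_refl (relIdeal k))
  have : relIdeal k ≤ J := by
    refine TwoSidedIdeal.span_le.mpr fun x hx => ?_
    refine (TwoSidedIdeal.mem_mk' _ _ _ _ _ _ _).mpr ⟨TwoSidedIdeal.subset_span hx, fun a => ?_⟩
    rcases hx with ⟨c, d, hcd⟩ | ⟨c, d, hcd⟩
    · rw [← mkₐ_eq_zero_iff, map_sub, map_sub, skew_freeH_mul_freeH, skew_freeH_mul_freeH,
        mk_skewQuad, mk_skewQuad, h.skewQuad_even a c d hcd, sub_self]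
    · rw [← mkₐ_eq_zero_iff, map_sub, map_sub, sub_eq_zero]
      simp only [map_add, Units.smul_def, map_zsmul, skew_freeH_mul_freeH, mk_skewQuad]
      exact h.skewQuad_odd a c d hcd
  exact ((TwoSidedIdeal.mem_mk' _ _ _ _ _ _ _).mp (this hx)).2 a

/-- The counit of `Λ'`. -/
noncomputable def counit (k : Type*) [CommRing k] : Free k →ₐ[k] k := FreeAlgebra.lift k fun _ => 0

theorem counit_freeH (n : ℤ) : counit k (freeH k n) = if n = 0 then 1 else 0 := by
  rcases lt_trichotomy n 0 with hn | rfl | hn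
  · rw [freeH_neg k hn, map_zero, if_neg hn.ne]
  · rw [freeH_zero, map_one, if_pos rfl]
  · obtain ⟨a, rfl⟩ := exists_pnat_of_pos hn
    rw [freeH_coe, counit, FreeAlgebra.lift_ι_apply, if_neg hn.ne']

/-- The sequence `1` at zero and `0` elsewhere satisfies the relations: when `a + b` is odd, neither
`(a, b)` nor `(a + 1, b - 1)` is `(0, 0)`. -/
theorem counit_eq_zero_of_mem_relIdeal {x : Free k} (hx : x ∈ relIdeal k) : counit k x = 0 := by
  refine relIdeal_le_ker (counit k) ?_ hx
  simp only [counit_freeH]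
  refine ⟨by simp, fun n hn => if_neg hn.ne, fun a b _ => mul_comm _ _, fun a b hab => ?_⟩
  have h1 : ¬ (b = 0 ∧ a = 0) := by
    rintro ⟨rfl, rfl⟩
    simp at hab
  have h2 : ¬ (b - 1 = 0 ∧ a + 1 = 0) := by
    rintro ⟨hb, ha⟩
    rw [show a + b = 0 by omega] at hab
    simp at hab
  simp only [← ite_and, mul_ite, mul_one, mul_zero, h1, h2]
  rw [and_comm] at h1 h2
  simp [h1, h2]

end Ideal

end OddSym

namespace OddSym

/-! ### Double cosets as contingency matrices, and their minimal lengths -/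

section Contingency

open Finset

variable {n r s : ℕ}

/-- The number of pairs of entries of a matrix in north-east to south-west position, counted with
multiplicity. -/
def matInv (M : Fin s → Fin r → ℕ) : ℕ :=
  ∑ j, ∑ i, M j i * ∑ l, ∑ m, M l m * if j < l ∧ m < i then 1 else 0

/-- The matrices of natural numbers with given row sums and column sums. -/
def contingency (α : Fin s → ℕ) (β : Fin r → ℤ) : Finset (Fin s → Fin r → ℕ) :=
  (Fintype.piFinset fun j => Nat.antidiagonalTuple r (α j)).filter
    fun M => ∀ i, ∑ j, (M j i : ℤ) = β i

theorem mem_contingency {α : Fin s → ℕ} {β : Fin r → ℤ} {M : Fin s → Fin r → ℕ} :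
    M ∈ contingency α β ↔ (∀ j, ∑ i, M j i = α j) ∧ ∀ i, ∑ j, (M j i : ℤ) = β i := by
  simp [contingency, Nat.mem_antidiagonalTuple]

theorem matInv_eq_sum_prod (M : Fin s → Fin r → ℕ) :
    matInv M = ∑ p : Fin s × Fin r, ∑ q : Fin s × Fin r,
      M p.1 p.2 * (M q.1 q.2 * if p.1 < q.1 ∧ q.2 < p.2 then 1 else 0) := by
  simp only [matInv, Fintype.sum_prod_type, mul_sum]

theorem matInv_transpose (M : Fin s → Fin r → ℕ) : matInv (fun i j => M j i) = matInv M := by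
  rw [matInv_eq_sum_prod, matInv_eq_sum_prod, sum_comm, ← (Equiv.prodComm _ _).sum_comp]
  refine sum_congr rfl fun p _ => ?_
  rw [← (Equiv.prodComm _ _).sum_comp]
  refine sum_congr rfl fun q _ => ?_
  simp only [Equiv.prodComm_apply, Prod.fst_swap, Prod.snd_swap, and_comm]
  rw [mul_left_comm]
  congr!

/-- The matrix counting how a permutation distributes the fibres of `A` among those of `B`. -/
def fiberMatrix (A : Fin n → Fin s) (B : Fin n → Fin r) (σ : Equiv.Perm (Fin n)) (j : Fin s)
    (i : Fin r) : ℕ :=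
  #{x | A x = j ∧ B (σ x) = i}

variable {A : Fin n → Fin s} {B : Fin n → Fin r}

theorem sum_fiberMatrix_mul (σ : Equiv.Perm (Fin n)) (f : Fin s → Fin r → ℕ) :
    ∑ j, ∑ i, fiberMatrix A B σ j i * f j i = ∑ x, f (A x) (B (σ x)) := by
  simp only [fiberMatrix, card_filter, sum_mul]
  rw [sum_congr rfl fun j _ => sum_comm, sum_comm]
  refine sum_congr rfl fun x _ => ?_
  simp [ite_and]

/-- These are the inversions forced by the matrix alone: both the two positions and the two values
lie in different blocks. -/
theorem matInv_fiberMatrix (σ : Equiv.Perm (Fin n)) :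
    matInv (fiberMatrix A B σ) =
      #{p : Fin n × Fin n | A p.1 < A p.2 ∧ B (σ p.2) < B (σ p.1)} := by
  rw [matInv, card_filter, ← univ_product_univ, sum_product]
  simp only [sum_fiberMatrix_mul σ fun l m => if _ < l ∧ m < _ then 1 else 0]
  exact sum_fiberMatrix_mul σ fun j i => ∑ y, if j < A y ∧ B (σ y) < i then 1 else 0

theorem sum_fiberMatrix_right (σ : Equiv.Perm (Fin n)) (j : Fin s) :
    ∑ i, fiberMatrix A B σ j i = #{x | A x = j} := by
  rw [card_eq_sum_card_fiberwise (f := fun x => B (σ x)) (t := univ) (by simp [Set.MapsTo])]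
  simp only [fiberMatrix, filter_filter]

theorem sum_fiberMatrix_left (σ : Equiv.Perm (Fin n)) (i : Fin r) :
    ∑ j, fiberMatrix A B σ j i = #{x | B x = i} := by
  have : #{x | B x = i} = #{x | B (σ x) = i} :=
    (card_equiv σ fun x => by simp).symm
  rw [this, card_eq_sum_card_fiberwise (f := A) (t := univ) (by simp [Set.MapsTo])]
  simp only [fiberMatrix, filter_filter, and_comm]

theorem exists_equiv_of_card_fiber {X Y Z : Type*} [Fintype X] [Fintype Y] [DecidableEq Z]
    (f : X → Z) (g : Y → Z) (h : ∀ z, #{x | f x = z} = #{y | g y = z}) :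
    ∃ e : X ≃ Y, ∀ x, g (e x) = f x := by
  have : ∀ z, Nonempty ({x // f x = z} ≃ {y // g y = z}) := fun z =>
    ⟨Fintype.equivOfCardEq (by simpa [Fintype.card_subtype] using h z)⟩
  exact ⟨Equiv.ofFiberEquiv fun z => (this z).some, Equiv.ofFiberEquiv_map _⟩

theorem fiberMatrix_mul {g h : Equiv.Perm (Fin n)} (hg : ∀ x, B (g x) = B x)
    (hh : ∀ x, A (h x) = A x) (σ : Equiv.Perm (Fin n)) :
    fiberMatrix A B (g * σ * h) = fiberMatrix A B σ := by
  ext j i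
  refine card_equiv h fun x => ?_
  simp [hg, hh]

/-- The maps `(A, B ∘ τ)` and `(A, B ∘ σ)` have fibres of equal size. A bijection matching them is
the right factor `h`, and `g` is then forced. -/
theorem exists_mul_of_fiberMatrix_eq {σ τ : Equiv.Perm (Fin n)}
    (h : fiberMatrix A B σ = fiberMatrix A B τ) :
    ∃ g : Equiv.Perm (Fin n), (∀ x, B (g x) = B x) ∧
      ∃ h : Equiv.Perm (Fin n), (∀ x, A (h x) = A x) ∧ τ = g * σ * h := by
  obtain ⟨e, he⟩ := exists_equiv_of_card_fiber (fun x => (A x, B (τ x))) (fun x => (A x, B (σ x)))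
    fun z => by
      have := congrFun (congrFun h z.1) z.2
      simpa only [fiberMatrix, Prod.ext_iff] using this.symm
  simp only [Prod.mk.injEq] at he
  refine ⟨τ * e⁻¹ * σ⁻¹, fun x => ?_, e, fun x => (he x).1, by group⟩
  have := (he (e⁻¹ (σ⁻¹ x))).2
  simpa using this.symm

theorem exists_fiberMatrix_eq {M : Fin s → Fin r → ℕ} (hA : ∀ j, ∑ i, M j i = #{x | A x = j})
    (hB : ∀ i, ∑ j, M j i = #{x | B x = i}) : ∃ σ, fiberMatrix A B σ = M := by
  -- `T` has `M j i` points labelled `(j, i)`. Matching it with `Fin n` by row label through `A` and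
  -- by column label through `B` gives two bijections, and the permutation is the second after the
  -- inverse of the first.
  let T := Σ p : Fin s × Fin r, Fin (M p.1 p.2)
  have hT : ∀ P : Fin s × Fin r → Prop, [DecidablePred P] →
      #{t : T | P t.1} = ∑ p with P p, M p.1 p.2 := by
    intro P _
    rw [card_filter, ← univ_sigma_univ, sum_sigma]
    simp only [sum_boole, Nat.cast_id, sum_filter]
    refine sum_congr rfl fun a _ => ?_
    split_ifs with h <;> simp [h]
  obtain ⟨e, he⟩ := exists_equiv_of_card_fiber (fun t : T => t.1.1) A fun j => by
    rw [hT fun p => p.1 = j, ← hA j, sum_filter, Fintype.sum_prod_type,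
      Fintype.sum_eq_single j fun j' hj => by simp [hj]]
    simp
  obtain ⟨e', he'⟩ := exists_equiv_of_card_fiber (fun t : T => t.1.2) B fun i => by
    rw [hT fun p => p.2 = i, ← hB i, sum_filter, Fintype.sum_prod_type_right,
      Fintype.sum_eq_single i fun i' hi => by simp [hi]]
    simp
  refine ⟨e.symm.trans e', ?_⟩
  ext j i
  have : fiberMatrix A B (e.symm.trans e') j i = #{t : T | t.1 = (j, i)} := by
    refine card_equiv e.symm fun x => ?_
    obtain ⟨t, rfl⟩ := e.surjective x
    simp [he, he', Prod.ext_iff]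
  rw [this, hT fun p => p = (j, i)]
  simp [sum_filter]

theorem matInv_fiberMatrix_le_permLength (hA : Monotone A) (hB : Monotone B)
    (σ : Equiv.Perm (Fin n)) : matInv (fiberMatrix A B σ) ≤ permLength σ := by
  rw [matInv_fiberMatrix, permLength]
  refine card_le_card fun p hp => ?_
  simp only [mem_filter, mem_univ, true_and] at hp ⊢
  exact ⟨hA.reflect_lt hp.1, hB.reflect_lt hp.2⟩

/-- A permutation can be sorted inside the fibres of `A` without leaving its double coset. -/
theorem exists_monotone_sort (hA : Monotone A) {ι : Type*} [LinearOrder ι] (f : Fin n → ι) :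
    ∃ a : Equiv.Perm (Fin n), (∀ x, A (a x) = A x) ∧
      ∀ x y, x ≤ y → A x = A y → f (a x) ≤ f (a y) := by
  let key : Fin n → Fin s ×ₗ ι := fun x => toLex (A x, f x)
  have hk : Monotone (key ∘ Tuple.sort key) := Tuple.monotone_sort key
  have hA' : Monotone (A ∘ Tuple.sort key) := fun x y hxy => by
    have := hk hxy
    rcases Prod.Lex.le_iff.mp this with h | h
    · exact le_of_lt h
    · exact le_of_eq h.1
  -- Sorting by the lexicographic key makes the rearranged `A` monotone; as `A` is already monotone,
  -- it equals its own sorted rearrangement.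
  have hAA : ∀ x, A (Tuple.sort key x) = A x := fun x => congrFun
    (Tuple.unique_monotone (f := A) (σ := Tuple.sort key) (τ := 1) hA' (by simpa using! hA)) x
  refine ⟨Tuple.sort key, hAA, fun x y hxy h => ?_⟩
  rcases Prod.Lex.le_iff.mp (hk hxy) with h' | h'
  · exact absurd h' (by simpa [key, hAA] using h.not_lt)
  · exact h'.2

/-- Sort first so that `B ∘ σ` increases on each fibre of `A`, then so that the inverse increases on
each fibre of `B`. In the result no inversion has both positions in one `A`-fibre or both values in
one `B`-fibre, so only the forced inversions remain. -/
theorem exists_permLength_eq_matInv (hA : Monotone A) (hB : Monotone B)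
    (σ : Equiv.Perm (Fin n)) :
    ∃ τ, fiberMatrix A B τ = fiberMatrix A B σ ∧ permLength τ = matInv (fiberMatrix A B σ) := by
  obtain ⟨a, haA, ha⟩ := exists_monotone_sort hA fun x => B (σ x)
  obtain ⟨b, hbB, hb⟩ := exists_monotone_sort hB fun x => (σ * a)⁻¹ x
  have hbB' : ∀ x, B (b⁻¹ x) = B x := fun x => by simpa using (hbB (b⁻¹ x)).symm
  have hτ : fiberMatrix A B (b⁻¹ * σ * a) = fiberMatrix A B σ := fiberMatrix_mul hbB' haA σ
  refine ⟨b⁻¹ * σ * a, hτ, ?_⟩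
  rw [← hτ, matInv_fiberMatrix, permLength]
  refine congrArg card (filter_congr fun p _ => ?_)
  obtain ⟨x, y⟩ := p
  constructor
  · rintro ⟨hxy, hlt⟩
    dsimp only at hxy hlt ⊢
    have h1 : B ((b⁻¹ * σ * a) y) ≠ B ((b⁻¹ * σ * a) x) := fun h => by
      have := hb _ _ hlt.le h
      simp at this
      exact absurd hxy this.not_gt
    have h2 : A x ≠ A y := fun h => by
      have h3 := ha x y hxy.le h
      have h4 := lt_of_le_of_ne (hB hlt.le) h1
      simp only [Equiv.Perm.mul_apply, hbB'] at h4
      exact absurd h3 h4.not_ge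
    exact ⟨lt_of_le_of_ne (hA hxy.le) h2, lt_of_le_of_ne (hB hlt.le) h1⟩
  · exact fun h => ⟨hA.reflect_lt h.1, hB.reflect_lt h.2⟩

end Contingency

end OddSym

namespace OddSym

/-! ### Platforms as fibres of a monotone map -/

section Block

theorem size_cons (a : ℕ+) (l : List ℕ+) : size (a :: l) = a + size l := by
  simp [size]

theorem ofFn_coe_get (l : List ℕ+) :
    (List.ofFn fun i => (l.get i : ℕ)) = l.map fun a : ℕ+ => (a : ℕ) := by
  conv_rhs => rw [← List.ofFn_get l, List.map_ofFn]
  rfl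

theorem size_eq_sum_get (l : List ℕ+) : size l = ∑ i, (l.get i : ℕ) := by
  induction l with
  | nil => rfl
  | cons a l ih =>
    rw [size_cons, ih]
    exact (Fin.sum_univ_succ fun i : Fin (l.length + 1) => (((a :: l).get i : ℕ+) : ℕ)).symm

theorem block_monotone (l : List ℕ+) : Monotone (block l) := by
  induction l with
  | nil => exact fun _ _ _ => le_rfl
  | cons a l ih =>
    intro x y hxy
    simp only [block]
    split_ifs with hx hy
    · exact le_rfl
    · exact Nat.zero_le _
    · omega
    · exact Nat.succ_le_succ (ih (by omega))

theorem block_lt_length (l : List ℕ+) {x : ℕ} (hx : x < size l) : block l x < l.length := by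
  induction l generalizing x with
  | nil => simp [size] at hx
  | cons a l ih =>
    rw [size_cons] at hx
    simp only [block, List.length_cons]
    split_ifs with h
    · omega
    · exact Nat.succ_lt_succ (ih (by omega))

theorem card_filter_block (l : List ℕ+) (j : Fin l.length) :
    ((Finset.range (size l)).filter fun x => block l x = j).card = l.get j := by
  induction l with
  | nil => exact j.elim0
  | cons a l ih =>
    rw [size_cons, Finset.range_eq_Ico, ← Finset.Ico_union_Ico_eq_Ico (Nat.zero_le _)
      (Nat.le_add_right (a : ℕ) (size l)), Finset.filter_union, Finset.card_union_of_disjoint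
      (Finset.disjoint_filter_filter (Finset.Ico_disjoint_Ico_consecutive _ _ _))]
    have h1 : ∀ x ∈ Finset.Ico 0 (a : ℕ), block (a :: l) x = 0 := fun x hx => by
      simp only [Finset.mem_Ico] at hx
      simp [block, hx.2]
    have h2 : ((Finset.Ico (a : ℕ) (a + size l)).filter fun x => block (a :: l) x = j).card =
        ((Finset.range (size l)).filter fun x => block l x + 1 = j).card := by
      symm
      refine Finset.card_bij (fun x _ => x + a) ?_ (fun _ _ _ _ h => by simpa using h) ?_
      · intro x hx
        simp only [Finset.mem_filter, Finset.mem_range, Finset.mem_Ico] at hx ⊢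
        exact ⟨by omega, by simpa [block] using hx.2⟩
      · intro x hx
        simp only [Finset.mem_filter, Finset.mem_range, Finset.mem_Ico] at hx ⊢
        rw [block] at hx
        exact ⟨x - a, ⟨by omega, by simpa [hx.1.1.not_gt] using hx.2⟩, by omega⟩
    rw [h2, Finset.filter_congr (q := fun _ => 0 = (j : ℕ)) fun x hx => by rw [h1 x hx]]
    refine Fin.cases ?_ (fun j => ?_) j
    · simp
    · simpa using ih j

/-- The platform containing a position. -/
def blockFin {n : ℕ} (l : List ℕ+) (h : size l = n) (x : Fin n) : Fin l.length :=
  ⟨block l x, block_lt_length l (h ▸ x.isLt)⟩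

theorem blockFin_monotone {n : ℕ} (l : List ℕ+) (h : size l = n) : Monotone (blockFin l h) :=
  fun _ _ hxy => block_monotone l hxy

theorem card_filter_blockFin {n : ℕ} (l : List ℕ+) (h : size l = n) (j : Fin l.length) :
    (Finset.univ.filter fun x => blockFin l h x = j).card = l.get j := by
  subst h
  rw [← card_filter_block l j]
  refine Finset.card_bij (fun x _ => x) ?_ (fun _ _ _ _ h => Fin.ext h) ?_
  · intro x hx
    simpa [blockFin, Fin.ext_iff] using hx
  · intro x hx
    simp only [Finset.mem_filter, Finset.mem_range] at hx
    exact ⟨⟨x, hx.1⟩, by simpa [blockFin, Fin.ext_iff] using hx.2, rfl⟩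

theorem mem_parabolic_iff {n : ℕ} (l : List ℕ+) (h : size l = n) (σ : Equiv.Perm (Fin n)) :
    σ ∈ parabolic n l ↔ ∀ x, blockFin l h (σ x) = blockFin l h x :=
  forall_congr' fun _ => by simp [blockFin]

end Block

/-! ### The form on words as a signed count of matrices -/

section WordForm

variable {n : ℕ} {β α : List ℕ+}

theorem mk_eq_mk_iff_fiberMatrix (hβ : size β = n) (hα : size α = n) (σ τ : Equiv.Perm (Fin n)) :
    DoubleCoset.mk (parabolic n β) (parabolic n α) σ =
      DoubleCoset.mk (parabolic n β) (parabolic n α) τ ↔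
    fiberMatrix (blockFin α hα) (blockFin β hβ) σ =
      fiberMatrix (blockFin α hα) (blockFin β hβ) τ := by
  rw [DoubleCoset.eq]
  constructor
  · rintro ⟨g, hg, h, hh, rfl⟩
    exact (fiberMatrix_mul ((mem_parabolic_iff β hβ g).mp hg)
      ((mem_parabolic_iff α hα h).mp hh) σ).symm
  · intro h
    obtain ⟨g, hg, h, hh, e⟩ := exists_mul_of_fiberMatrix_eq h
    exact ⟨g, (mem_parabolic_iff β hβ g).mpr hg, h, (mem_parabolic_iff α hα h).mpr hh, e⟩

theorem cosetLength_mk (hβ : size β = n) (hα : size α = n) (σ : Equiv.Perm (Fin n)) :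
    cosetLength (DoubleCoset.mk (parabolic n β) (parabolic n α) σ) =
      matInv (fiberMatrix (blockFin α hα) (blockFin β hβ) σ) := by
  refine le_antisymm ?_ ?_
  · obtain ⟨τ, hτ, h⟩ := exists_permLength_eq_matInv (blockFin_monotone α hα)
      (blockFin_monotone β hβ) σ
    exact Nat.sInf_le ⟨τ, (mk_eq_mk_iff_fiberMatrix hβ hα τ σ).mpr hτ, h⟩
  · refine le_csInf ⟨_, σ, rfl, rfl⟩ ?_
    rintro _ ⟨τ, hτ, rfl⟩
    rw [← (mk_eq_mk_iff_fiberMatrix hβ hα τ σ).mp hτ]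
    exact matInv_fiberMatrix_le_permLength (blockFin_monotone α hα) (blockFin_monotone β hβ) τ

/-- The form on words as a sum over contingency matrices. -/
theorem wordForm_eq_sum_contingency (k : Type*) [CommRing k] (q : k) (β α : List ℕ+) :
    wordForm k q β α = ∑ M ∈ contingency (fun j => (α.get j : ℕ)) (fun i => ((β.get i : ℕ) : ℤ)),
      q ^ matInv M := by
  rw [wordForm]
  split_ifs with h
  · refine Finset.sum_bij
      (fun c _ => fiberMatrix (blockFin α rfl) (blockFin β h) (Quotient.out c)) ?_ ?_ ?_ ?_
    · intro c _
      rw [mem_contingency]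
      refine ⟨fun j => ?_, fun i => ?_⟩
      · rw [sum_fiberMatrix_right, card_filter_blockFin]
      · rw [← Nat.cast_sum, sum_fiberMatrix_left, card_filter_blockFin]
    · intro c _ d _ hcd
      rw [← mk_eq_mk_iff_fiberMatrix h rfl] at hcd
      simpa only [DoubleCoset.out_eq'] using hcd
    · intro M hM
      rw [mem_contingency] at hM
      obtain ⟨σ, hσ⟩ := exists_fiberMatrix_eq (A := blockFin α rfl) (B := blockFin β h) (M := M)
        (fun j => by rw [hM.1, card_filter_blockFin])
        (fun i => by rw [card_filter_blockFin]; exact_mod_cast hM.2 i)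
      refine ⟨DoubleCoset.mk _ _ σ, Finset.mem_univ _, ?_⟩
      rw [← hσ, ← mk_eq_mk_iff_fiberMatrix h rfl, DoubleCoset.out_eq']
    · intro c _
      rw [← cosetLength_mk h rfl, DoubleCoset.out_eq']
  -- For unequal sizes there are no matrices: row sums and column sums would add up to different
  -- totals.
  · rw [Finset.sum_eq_zero]
    intro M hM
    rw [mem_contingency] at hM
    refine absurd ?_ h
    rw [size_eq_sum_get, size_eq_sum_get, ← Finset.sum_congr rfl fun j _ => hM.1 j, Finset.sum_comm]
    refine Finset.sum_congr rfl fun i _ => ?_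
    exact_mod_cast (hM.2 i).symm

theorem wordForm_comm (k : Type*) [CommRing k] (q : k) (β α : List ℕ+) :
    wordForm k q β α = wordForm k q α β := by
  rw [wordForm_eq_sum_contingency, wordForm_eq_sum_contingency]
  refine Finset.sum_nbij' (fun M i j => M j i) (fun M i j => M j i) ?_ ?_ (fun _ _ => rfl)
    (fun _ _ => rfl) fun M _ => by rw [matInv_transpose]
  · intro M hM
    rw [mem_contingency] at hM ⊢
    exact ⟨fun i => by exact_mod_cast hM.2 i, fun j => by exact_mod_cast hM.1 j⟩
  · intro M hM
    rw [mem_contingency] at hM ⊢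
    exact ⟨fun i => by exact_mod_cast hM.2 i, fun j => by exact_mod_cast hM.1 j⟩

end WordForm

end OddSym

namespace OddSym

/-! ### Skewing as the adjoint of multiplication -/

section Adjunction

variable {k : Type*} [CommRing k]

theorem sum_antidiagonalTuple_succ {N : Type*} [AddCommMonoid N] (r a : ℕ)
    (f : (Fin (r + 1) → ℕ) → N) :
    ∑ m ∈ Finset.Nat.antidiagonalTuple (r + 1) a, f m =
      ∑ p ∈ Finset.HasAntidiagonal.antidiagonal a, ∑ m ∈ Finset.Nat.antidiagonalTuple r p.2,
        f (Fin.cons p.1 m) := by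
  rw [Finset.sum_sigma']
  refine Finset.sum_nbij' (fun m => ⟨(m 0, ∑ i, Fin.tail m i), Fin.tail m⟩)
    (fun q => Fin.cons q.1.1 q.2) ?_ ?_ ?_ ?_ ?_
  · intro m hm
    rw [Finset.Nat.mem_antidiagonalTuple, Fin.sum_univ_succ] at hm
    simp [Finset.Nat.mem_antidiagonalTuple, ← hm, Fin.tail]
  · rintro ⟨⟨i, j⟩, m⟩ h
    simp only [Finset.mem_sigma, Finset.HasAntidiagonal.mem_antidiagonal,
      Finset.Nat.mem_antidiagonalTuple] at h
    simp [Finset.Nat.mem_antidiagonalTuple, Fin.sum_univ_succ, h]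
  · intro m _
    simp
  · rintro ⟨⟨i, j⟩, m⟩ h
    simp only [Finset.mem_sigma, Finset.HasAntidiagonal.mem_antidiagonal,
      Finset.Nat.mem_antidiagonalTuple] at h
    obtain ⟨-, rfl⟩ := h
    simp
  · intro m _
    simp

/-- The product of the `h_n` indexed by a tuple. -/
noncomputable def tupleH (k : Type*) [CommRing k] {r : ℕ} (β : Fin r → ℤ) : Free k :=
  (List.ofFn fun i => freeH k (β i)).prod

theorem tupleH_succ {r : ℕ} (β : Fin (r + 1) → ℤ) :
    tupleH k β = freeH k (β 0) * tupleH k fun i => β i.succ := by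
  rw [tupleH, List.ofFn_succ, List.prod_cons, tupleH]

/-- The number of inversions between two consecutive columns of a matrix. -/
def pairInv {r : ℕ} (m b : Fin r → ℤ) : ℤ :=
  ∑ i, m i * ∑ j, b j * if j < i then 1 else 0

theorem pairInv_succ {r : ℕ} (m b : Fin (r + 1) → ℤ) :
    pairInv m b = (∑ i : Fin r, m i.succ) * b 0 +
      pairInv (fun i => m i.succ) fun i => b i.succ := by
  simp only [pairInv, Fin.sum_univ_succ, Finset.sum_mul, ← Finset.sum_add_distrib]
  simp [mul_add, Finset.sum_add_distrib]

/-- The tuple `m` records how much is removed from each factor. The Leibniz signs count the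
inversions between the removed row `m` and what is left, `β - m`. -/
theorem skew_tupleH (a : ℕ) {r : ℕ} (β : Fin r → ℤ) :
    skew k a (tupleH k β) = ∑ m ∈ Finset.Nat.antidiagonalTuple r a,
      (pairInv (fun i => (m i : ℤ)) fun i => β i - m i).negOnePow •
        tupleH k fun i => β i - m i := by
  induction r generalizing a with
  | zero =>
    rcases a with _ | a
    · simp [tupleH, skew_one, pairInv]
    · simp [tupleH, skew_one]
  | succ r ih =>
    rw [tupleH_succ, skew_mul, sum_antidiagonalTuple_succ]
    refine Finset.sum_congr rfl fun p _ => ?_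
    rw [skew_freeH, parity_pow_freeH, ih, Finset.mul_sum]
    refine Finset.sum_congr rfl fun m hm => ?_
    rw [Finset.Nat.mem_antidiagonalTuple] at hm
    rw [smul_mul_smul_comm, pairInv_succ, tupleH_succ, Int.negOnePow_add, ← hm]
    simp

/-- The composition of the operators `skew` attached to a word. -/
noncomputable def skewList (k : Type*) [CommRing k] : List ℕ → Free k →ₗ[k] Free k
  | [] => LinearMap.id
  | a :: l => skewList k l ∘ₗ skew k a

theorem counit_tupleH {r : ℕ} (β : Fin r → ℤ) :
    counit k (tupleH k β) = if ∀ i, β i = 0 then 1 else 0 := by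
  induction r with
  | zero => simp [tupleH]
  | succ r ih =>
    rw [tupleH_succ, map_mul, ih, counit_freeH]
    simp only [Fin.forall_fin_succ]
    split_ifs <;> simp_all

theorem matInv_cons {r s : ℕ} (m : Fin r → ℕ) (M : Fin s → Fin r → ℕ) :
    (matInv (Fin.cons m M : Fin (s + 1) → Fin r → ℕ) : ℤ) =
      pairInv (fun i => (m i : ℤ)) (fun i => ∑ j, (M j i : ℤ)) + matInv M := by
  simp only [matInv, Fin.sum_univ_succ, Fin.cons_zero, Fin.cons_succ, pairInv]
  push_cast
  congr 1
  · refine Finset.sum_congr rfl fun i _ => ?_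
    simp only [lt_self_iff_false, false_and, if_false, mul_zero, Finset.sum_const_zero, zero_add,
      Fin.succ_pos, true_and, Finset.sum_mul]
    rw [Finset.sum_comm]
  · simp

/-- Each skewing splits off the top row of the matrix, with remaining column sums `β - m`; by
`matInv_cons` its sign is that row's share of `matInv`. Column sums are integers so that removing
too much simply leaves an empty set of matrices. -/
theorem counit_skewList_tupleH {r s : ℕ} (α : Fin s → ℕ) (β : Fin r → ℤ) :
    counit k (skewList k (List.ofFn α) (tupleH k β)) =
      ∑ M ∈ contingency α β, (-1) ^ matInv M := by
  induction s generalizing β with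
  | zero =>
    rw [List.ofFn_zero, skewList, LinearMap.id_apply, counit_tupleH]
    rw [contingency, Finset.sum_filter]
    simp [eq_comm, matInv]
  | succ s ih =>
    rw [List.ofFn_succ, skewList, LinearMap.comp_apply, skew_tupleH]
    simp only [map_sum, Units.smul_def, map_zsmul, ih]
    simp only [Finset.smul_sum]
    rw [Finset.sum_sigma']
    refine Finset.sum_nbij' (fun q => Fin.cons q.1 q.2) (fun M => ⟨M 0, Fin.tail M⟩) ?_ ?_ ?_ ?_ ?_
    · rintro ⟨m, M⟩ h
      simp only [Finset.mem_sigma, Finset.Nat.mem_antidiagonalTuple, mem_contingency] at h ⊢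
      refine ⟨Fin.cases (by simpa using h.1) (by simpa using h.2.1), fun i => ?_⟩
      rw [Fin.sum_univ_succ]
      simp [h.2.2]
    · intro M hM
      rw [mem_contingency] at hM
      simp only [Finset.mem_sigma, Finset.Nat.mem_antidiagonalTuple, mem_contingency]
      refine ⟨hM.1 0, fun j => hM.1 j.succ, fun i => ?_⟩
      rw [← hM.2 i, Fin.sum_univ_succ]
      simp [Fin.tail]
    · rintro ⟨m, M⟩ _
      simp
    · intro M _
      simp
    · rintro ⟨m, M⟩ h
      simp only [Finset.mem_sigma, mem_contingency] at h
      have e := matInv_cons m M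
      simp only [h.2.2] at e
      rw [← Int.cast_smul_eq_zsmul k, ← Int.cast_negOnePow_natCast k, ← Int.cast_negOnePow_natCast k,
        e, Int.negOnePow_add, Units.val_mul, Int.cast_mul, smul_eq_mul]

theorem tupleH_get (β : List ℕ+) :
    tupleH k (fun i => ((β.get i : ℕ) : ℤ)) = (β.map (FreeAlgebra.ι k)).prod := by
  conv_rhs => rw [← List.ofFn_get β, List.map_ofFn]
  rw [tupleH]
  congr 1
  refine congrArg _ (funext fun i => ?_)
  rw [freeH_coe, Function.comp]

theorem form_word_word (q : k) (β α : List ℕ+) :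
    form k q ((β.map (FreeAlgebra.ι k)).prod) ((α.map (FreeAlgebra.ι k)).prod) =
      wordForm k q β α := by
  rw [← basisFreeMonoid_ofList, ← basisFreeMonoid_ofList, form, Module.Basis.constr_basis,
    Module.Basis.constr_basis, FreeMonoid.toList_ofList, FreeMonoid.toList_ofList]

theorem word_ext {N : Type*} [AddCommMonoid N] [Module k N] {f g : Free k →ₗ[k] N}
    (h : ∀ w : List ℕ+, f ((w.map (FreeAlgebra.ι k)).prod) = g ((w.map (FreeAlgebra.ι k)).prod)) :
    f = g := by
  refine (FreeAlgebra.basisFreeMonoid k ℕ+).ext fun w => ?_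
  obtain ⟨w, rfl⟩ := FreeMonoid.ofList.surjective w
  rw [basisFreeMonoid_ofList, h]

theorem form_comm (q : k) (x y : Free k) : form k q x y = form k q y x := by
  have : form k q = LinearMap.flip (form k q) := by
    refine word_ext fun β => word_ext fun α => ?_
    rw [LinearMap.flip_apply, form_word_word, form_word_word, wordForm_comm]
  exact LinearMap.congr_fun₂ this x y

theorem form_word (x : Free k) (α : List ℕ+) :
    form k (-1) x ((α.map (FreeAlgebra.ι k)).prod) =
      counit k (skewList k (α.map fun a : ℕ+ => (a : ℕ)) x) := by
  have : LinearMap.flip (form k (-1)) ((α.map (FreeAlgebra.ι k)).prod) =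
      (counit k).toLinearMap ∘ₗ skewList k (α.map fun a : ℕ+ => (a : ℕ)) := by
    refine word_ext fun β => ?_
    rw [LinearMap.flip_apply, form_word_word, wordForm_eq_sum_contingency, LinearMap.comp_apply,
      ← tupleH_get, ← ofFn_coe_get, AlgHom.toLinearMap_apply, counit_skewList_tupleH]
  exact LinearMap.congr_fun this x

theorem mem_radical_iff (x : Free k) : x ∈ radical k (-1) ↔
    ∀ α : List ℕ+, counit k (skewList k (α.map fun a : ℕ+ => (a : ℕ)) x) = 0 := by
  refine ⟨fun h α => by rw [← form_word, h], fun h y => ?_⟩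
  have : form k (-1) x = 0 := word_ext fun α => by rw [form_word, h, LinearMap.zero_apply]
  rw [this, LinearMap.zero_apply]

theorem skewList_mem_relIdeal {x : Free k} (hx : x ∈ relIdeal k) (l : List ℕ) :
    skewList k l x ∈ relIdeal k := by
  induction l generalizing x with
  | nil => exact hx
  | cons a l ih => exact ih (skew_mem_relIdeal hx a)

theorem mem_radical_of_mem_relIdeal {x : Free k} (hx : x ∈ relIdeal k) :
    x ∈ radical k (-1) :=
  (mem_radical_iff x).mpr fun _ => counit_eq_zero_of_mem_relIdeal (skewList_mem_relIdeal hx _)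

theorem mem_radical_of_skew {x : Free k} (h0 : counit k x = 0)
    (h : ∀ a : ℕ, 0 < a → skew k a x ∈ radical k (-1)) : x ∈ radical k (-1) := by
  refine (mem_radical_iff x).mpr fun α => ?_
  rcases α with _ | ⟨a, α⟩
  · exact h0
  · exact (mem_radical_iff _).mp (h a a.pos) α

end Adjunction

end OddSym

namespace OddSym

/-! ### Convolution inverses -/

section ConvInv

variable {R S : Type*} [Ring R] [Ring S]

/-- The convolution inverse of a sequence `g` with `g 0 = 1`. -/
def convInv (g : ℤ → R) : ℕ → R
  | 0 => 1
  | n + 1 => -∑ j : Fin (n + 1), convInv g j * g ((n + 1 : ℕ) - (j : ℕ))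

theorem convInv_succ (g : ℤ → R) (n : ℕ) :
    convInv g (n + 1) =
      -∑ j ∈ Finset.range (n + 1), convInv g j * g ((n + 1 : ℕ) - (j : ℕ)) := by
  rw [convInv, Fin.sum_univ_eq_sum_range fun j => convInv g j * g ((n + 1 : ℕ) - (j : ℕ))]

theorem sum_convInv {g : ℤ → R} (hg : g 0 = 1) {n : ℕ} (hn : n ≠ 0) :
    ∑ j ∈ Finset.range (n + 1), convInv g j * g ((n : ℤ) - j) = 0 := by
  obtain ⟨m, rfl⟩ := Nat.exists_eq_succ_of_ne_zero hn
  rw [Finset.sum_range_succ, sub_self, hg, mul_one, Nat.succ_eq_add_one, convInv_succ,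
    add_neg_cancel]

theorem map_convInv (f : R →+* S) (g : ℤ → R) (n : ℕ) :
    f (convInv g n) = convInv (fun m => f (g m)) n := by
  induction n using Nat.strong_induction_on with
  | _ n ih =>
    rcases n with _ | n
    · rw [convInv, convInv, map_one]
    · rw [convInv_succ, convInv_succ, map_neg, map_sum]
      congr 1
      refine Finset.sum_congr rfl fun j hj => ?_
      rw [map_mul, ih j (Finset.mem_range.mp hj)]

/-- The convolution inverse, extended by zero to negative indices. -/
def convInvInt (g : ℤ → R) (n : ℤ) : R := if n < 0 then 0 else convInv g n.toNat

theorem convInvInt_natCast (g : ℤ → R) (n : ℕ) : convInvInt g n = convInv g n := by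
  simp [convInvInt]

theorem convInvInt_neg (g : ℤ → R) {n : ℤ} (hn : n < 0) : convInvInt g n = 0 := if_pos hn

theorem convInvInt_zero (g : ℤ → R) : convInvInt g 0 = 1 := by
  simp [convInvInt, convInv]

end ConvInv

/-! ### Elementary functions and independence of sorted words modulo the radical -/

section Elementary

variable (k : Type*) [CommRing k]

/-- Signed elementary functions in `Λ'`. -/
noncomputable def freeE (n : ℤ) : Free k := convInvInt (freeH k) n

variable {k}

theorem skew_zero (x : Free k) : skew k 0 x = x := by
  induction x using FreeAlgebra.induction with
  | grade0 r => rw [skew_algebraMap, if_pos rfl]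
  | grade1 b => rw [skew_ι, Nat.cast_zero, sub_zero, freeH_coe]
  | mul x y hx hy => simp [skew_mul, hx, hy]
  | add x y hx hy => rw [map_add, hx, hy]

theorem parity_freeE (n : ℤ) : parity k (freeE k n) = n.negOnePow • freeE k n := by
  rcases lt_or_ge n 0 with hn | hn
  · simp [freeE, convInvInt_neg _ hn]
  lift n to ℕ using hn
  rw [freeE, convInvInt_natCast]
  induction n using Nat.strong_induction_on with
  | _ n ih =>
    rcases n with _ | n
    · simp [convInv]
    · rw [convInv_succ, map_neg, map_sum, smul_neg, Finset.smul_sum]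
      congr 1
      refine Finset.sum_congr rfl fun j hj => ?_
      rw [map_mul, ih j (Finset.mem_range.mp hj), parity_freeH, smul_mul_smul_comm,
        ← Int.negOnePow_add]
      congr 2
      ring

theorem parity_pow_freeE (j : ℕ) (n : ℤ) :
    (parity k ^ j) (freeE k n) = ((j : ℤ) * n).negOnePow • freeE k n := by
  induction j with
  | zero => simp
  | succ j ih =>
    rw [pow_succ, AlgHom.mul_apply, parity_freeE, Units.smul_def, map_zsmul, ← Units.smul_def, ih,
      smul_smul, ← Int.negOnePow_add]
    congr 2
    push_cast
    ring

theorem skew_succ_mul {x : Free k} (hx : ∀ b, skew k (b + 2) x = 0) (b : ℕ) (y : Free k) :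
    skew k (b + 1) (x * y) =
      (parity k ^ (b + 1)) x * skew k (b + 1) y + (parity k ^ b) (skew k 1 x) * skew k b y := by
  rw [skew_mul, Finset.Nat.sum_antidiagonal_succ, skew_zero]
  congr 1
  rw [Finset.sum_eq_single (0, b)]
  · rintro ⟨i, j⟩ h hne
    obtain ⟨i, rfl⟩ := Nat.exists_eq_succ_of_ne_zero (n := i) fun h0 => hne (by simp_all)
    simp [hx]
  · simp

/-- By induction on `n`, skewing the recursion for the convolution inverse gives a telescoping sum.
Only a multiple of `e_{n-1} h_{1-b}` survives for `skew b` with `b ≥ 1`, and it vanishes once `b ≥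
2`. -/
theorem skew_freeE (n : ℤ) : skew k 1 (freeE k n) = n.negOnePow • freeE k (n - 1) ∧
    ∀ b, skew k (b + 2) (freeE k n) = 0 := by
  rcases lt_or_ge n 0 with hn | hn
  · simp [freeE, convInvInt_neg _ hn, convInvInt_neg _ (show n - 1 < 0 by omega)]
  lift n to ℕ using hn
  induction n using Nat.strong_induction_on with
  | _ n ih =>
    rcases n with _ | n
    · simp [freeE, convInvInt_zero, convInvInt_neg _ (show (-1 : ℤ) < 0 by omega), skew_one]
    · have key : ∀ b, skew k (b + 1) (freeE k (n + 1 : ℕ)) =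
          - ((((b : ℤ) + 1) * n).negOnePow • (freeE k n * freeH k (-b))) := by
        intro b
        -- The skewing of the `j`-th summand is `T (j + 1) - T j`. The lower end `T 0` is zero
        -- because it contains `e_{-1}`.
        let T : ℕ → Free k := fun i => (((b : ℤ) + 1) * (i - 1)).negOnePow •
          (freeE k (i - 1) * freeH k (n + 1 - i - b))
        have h1 : ∀ j ∈ Finset.range (n + 1),
            skew k (b + 1) (convInv (freeH k) j * freeH k ((n + 1 : ℕ) - (j : ℕ))) =
              T (j + 1) - T j := by
          intro j hj
          obtain ⟨ih1, ih2⟩ := ih j (Finset.mem_range.mp hj)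
          rw [← convInvInt_natCast, ← freeE, skew_succ_mul ih2, ih1, parity_pow_freeE,
            Units.smul_def (Int.negOnePow j), map_zsmul, ← Units.smul_def, parity_pow_freeE, skew_freeH,
            skew_freeH, smul_smul, ← Int.negOnePow_add, sub_eq_add_neg]
          congr 1
          · simp only [T, smul_mul_assoc]
            push_cast
            congr 3 <;> ring_nf
          · rw [smul_mul_assoc, show T j = (((b : ℤ) + 1) * (j - 1)).negOnePow •
              (freeE k (j - 1) * freeH k (n + 1 - j - b)) from rfl, ← Units.neg_smul,
              ← Int.negOnePow_succ, Nat.cast_succ]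
            congr 1
            · rw [Int.negOnePow_eq_iff]
              simp only [Int.even_sub, Int.even_add, Int.even_mul, Int.not_even_one]
              tauto
        rw [freeE, convInvInt_natCast, convInv_succ, map_neg, map_sum, Finset.sum_congr rfl h1,
          Finset.sum_range_sub]
        simp [T, freeE, convInvInt_neg]
      refine ⟨?_, fun b => ?_⟩
      · rw [key 0, ← Units.neg_smul, ← Int.negOnePow_succ]
        simp [freeH_zero]
      · rw [key (b + 1), freeH_neg k (by omega)]
        simp

theorem skew_succ_freeE_mul (n : ℤ) (b : ℕ) (y : Free k) :
    skew k (b + 1) (freeE k n * y) = (((b : ℤ) + 1) * n).negOnePow • (freeE k n * skew k (b + 1) y) +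
      (n + b * (n - 1)).negOnePow • (freeE k (n - 1) * skew k b y) := by
  rw [skew_succ_mul (skew_freeE n).2, (skew_freeE n).1, parity_pow_freeE,
    Units.smul_def n.negOnePow, map_zsmul, ← Units.smul_def, parity_pow_freeE, smul_smul,
    ← Int.negOnePow_add, smul_mul_assoc, smul_mul_assoc]
  push_cast
  rfl

variable (k) in
/-- The product of elementary functions indexed by a list. -/
noncomputable def wordE (μ : List ℕ) : Free k := (μ.map fun m : ℕ => freeE k m).prod

theorem wordE_cons (m : ℕ) (μ : List ℕ) : wordE k (m :: μ) = freeE k m * wordE k μ := by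
  rw [wordE, List.map_cons, List.prod_cons, wordE]

theorem freeE_zero : freeE k 0 = 1 := convInvInt_zero _

/-- Each elementary factor can lose at most one unit of degree, so the largest nonzero skewing
lowers every factor of positive degree by exactly one. -/
theorem skew_wordE (μ : List ℕ) :
    (∀ b, μ.countP (0 < ·) < b → skew k b (wordE k μ) = 0) ∧
      ∃ u : ℤˣ, skew k (μ.countP (0 < ·)) (wordE k μ) = u • wordE k (μ.map (· - 1)) := by
  induction μ with
  | nil =>
    refine ⟨fun b hb => ?_, 1, ?_⟩
    · simp only [List.countP_nil] at hb
      simp [wordE, skew_one, hb.ne']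
    · simp [wordE, skew_one]
  | cons m μ ih =>
    obtain ⟨ih1, u, ih2⟩ := ih
    rcases m with _ | m
    · simp only [wordE_cons, Nat.cast_zero, freeE_zero, one_mul, List.map_cons,
        List.countP_cons, lt_self_iff_false, decide_false, Nat.zero_sub]
      exact ⟨by simpa using ih1, u, by simpa using ih2⟩
    · have hc : ((m + 1) :: μ).countP (0 < ·) = μ.countP (0 < ·) + 1 := by simp
      rw [hc, wordE_cons]
      refine ⟨fun b hb => ?_, (((m + 1 : ℕ) : ℤ) +
        (μ.countP (0 < ·)) * (((m + 1 : ℕ) : ℤ) - 1)).negOnePow * u, ?_⟩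
      · obtain ⟨b, rfl⟩ := Nat.exists_eq_succ_of_ne_zero (show b ≠ 0 by omega)
        rw [Nat.succ_eq_add_one, skew_succ_freeE_mul, ih1 _ (by omega), ih1 _ (by omega)]
        simp
      · rw [skew_succ_freeE_mul, ih1 _ (by omega), ih2, mul_zero, smul_zero, zero_add,
          List.map_cons, wordE_cons, mul_smul, mul_smul_comm]
        simp

/-- The conjugate of a partition, padded by zeros to length `N`. -/
def conj (N : ℕ) (l : List ℕ+) : List ℕ :=
  (List.range N).map fun j => l.countP fun a : ℕ+ => j < (a : ℕ)

theorem countP_range_lt {N a : ℕ} (h : a ≤ N) : (List.range N).countP (fun j => j < a) = a := by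
  induction N generalizing a with
  | zero => simp_all
  | succ N ih =>
    rw [List.range_succ, List.countP_append]
    rcases h.eq_or_lt with rfl | h
    · rw [List.countP_congr (q := fun j => decide (j < N)) fun x hx => by
        simp only [List.mem_range] at hx
        simp [hx, Nat.lt_succ_of_lt hx], ih le_rfl]
      simp
    · rw [ih (by omega)]
      simp; omega

theorem countP_conj {N : ℕ} {a : ℕ+} {l : List ℕ+} (h : ∀ b ∈ l, b ≤ a) (ha : (a : ℕ) ≤ N) :
    (conj N (a :: l)).countP (0 < ·) = a := by
  rw [conj, List.countP_map, ← countP_range_lt ha]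
  refine List.countP_congr fun j _ => ?_
  simp only [Function.comp, decide_eq_true_eq, List.countP_pos_iff, List.mem_cons, exists_eq_or_imp]
  refine ⟨?_, Or.inl⟩
  rintro (h' | ⟨b, hb, h'⟩)
  · exact h'
  · exact h'.trans_le (h b hb)

theorem map_pred_conj {N : ℕ} {a : ℕ+} {l : List ℕ+} (h : ∀ b ∈ l, b ≤ a) :
    (conj N (a :: l)).map (· - 1) = conj N l := by
  rw [conj, List.map_map, conj]
  refine List.map_congr_left fun j _ => ?_
  simp only [Function.comp, List.countP_cons]
  split_ifs with hj
  · simp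
  · simp only [decide_eq_true_eq] at hj
    have : l.countP (fun a : ℕ+ => j < (a : ℕ)) = 0 := by
      rw [List.countP_eq_zero]
      intro b hb
      have := PNat.coe_le_coe _ _ |>.mpr (h b hb)
      simp; omega
    simp [this]

theorem wordE_conj_nil (N : ℕ) : wordE k (conj N []) = 1 := by
  rw [wordE, List.prod_eq_one]
  simp [conj, freeE_zero]

/-- The largest part of `l` is the number of positive parts of its conjugate, so skewing by it
deletes the first part of `l` up to sign. A lexicographically larger `κ` exceeds `l` at the first
difference: either its letter there is too large for a nonzero skewing, or `l` is exhausted and `1`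
is skewed by a positive amount. -/
theorem counit_skewList_wordE_conj {N : ℕ} {l : List ℕ+} (hl : l.Pairwise (· ≥ ·))
    (hN : ∀ a ∈ l, (a : ℕ) ≤ N) :
    (∃ u : ℤˣ, counit k (skewList k (l.map fun a : ℕ+ => (a : ℕ)) (wordE k (conj N l))) = u • 1) ∧
      ∀ κ : List ℕ+, l < κ →
        counit k (skewList k (κ.map fun a : ℕ+ => (a : ℕ)) (wordE k (conj N l))) = 0 := by
  induction l with
  | nil =>
    rw [wordE_conj_nil]
    refine ⟨⟨1, by simp [skewList]⟩, fun κ hκ => ?_⟩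
    rcases κ with _ | ⟨b, κ⟩
    · exact absurd hκ (lt_irrefl _)
    · simp [skewList, skew_one]
  | cons a l ih =>
    rw [List.pairwise_cons] at hl
    have ha : (a : ℕ) ≤ N := hN a List.mem_cons_self
    obtain ⟨⟨u, ih1⟩, ih2⟩ := ih hl.2 fun b hb => hN b (List.mem_cons_of_mem _ hb)
    obtain ⟨h1, v, h2⟩ := skew_wordE (k := k) (conj N (a :: l))
    rw [countP_conj hl.1 ha] at h1 h2
    rw [map_pred_conj hl.1] at h2
    refine ⟨⟨v * u, ?_⟩, fun κ hκ => ?_⟩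
    · rw [List.map_cons, skewList, LinearMap.comp_apply, h2, Units.smul_def v, map_zsmul, map_zsmul,
        ih1, ← Units.smul_def, smul_smul]
    · rcases κ with _ | ⟨b, κ⟩
      · exact absurd hκ (by simp)
      rw [List.map_cons, skewList, LinearMap.comp_apply]
      rcases List.cons_lt_cons_iff.mp hκ with hab | ⟨rfl, hlκ⟩
      · rw [h1 b (by exact_mod_cast hab), map_zero, map_zero]
      · rw [h2, Units.smul_def, map_zsmul, map_zsmul, ih2 κ hlκ, smul_zero]

/-- Linear combinations of sorted words meet the radical trivially. -/
theorem eq_zero_of_linearCombination_mem_radical {c : List ℕ+ →₀ k}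
    (hc : ∀ l ∈ c.support, l.Pairwise (· ≥ ·))
    (h : Finsupp.linearCombination k (fun l : List ℕ+ => (l.map (FreeAlgebra.ι k)).prod) c ∈
      radical k (-1)) : c = 0 := by
  by_contra hne
  have hs : c.support.Nonempty := Finsupp.support_nonempty_iff.mpr hne
  -- With `l` lexicographically least in the support, pairing with the product for its conjugate
  -- kills every other term and leaves the coefficient of `l` times a sign.
  set l := c.support.min' hs
  have hl : l ∈ c.support := c.support.min'_mem hs
  have hN : ∀ a ∈ l, (a : ℕ) ≤ l.toFinset.sup fun a : ℕ+ => (a : ℕ) := fun a ha =>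
    Finset.le_sup (f := fun a : ℕ+ => (a : ℕ)) (List.mem_toFinset.mpr ha)
  obtain ⟨⟨u, h1⟩, h2⟩ := counit_skewList_wordE_conj (k := k) (hc l hl) hN
  have h3 := h (wordE k (conj (l.toFinset.sup fun a : ℕ+ => (a : ℕ)) l))
  rw [form_comm, Finsupp.linearCombination_apply, Finsupp.sum, map_sum,
    Finset.sum_eq_single_of_mem l hl] at h3
  · rw [map_smul, form_word, h1, smul_eq_mul, Units.smul_def, mul_smul_comm, mul_one] at h3
    refine Finsupp.mem_support_iff.mp hl ?_
    rwa [← Units.smul_def, smul_eq_zero_iff_eq] at h3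
  · intro κ hκ hne
    rw [map_smul, form_word, h2 κ (lt_of_le_of_ne (c.support.min'_le κ hκ) (Ne.symm hne)),
      smul_zero]

end Elementary

end OddSym

namespace OddSym

/-! ### Sorted words span modulo the relations -/

section Spanning

variable {k : Type*} [CommRing k] {R : Type*} [Ring R] [Algebra k R] {g : ℤ → R}

/-- The product of the terms of a sequence indexed by a word. -/
def wordProd (g : ℤ → R) (w : List ℕ+) : R := (w.map fun a : ℕ+ => g (a : ℕ)).prod

theorem wordProd_cons (g : ℤ → R) (a : ℕ+) (w : List ℕ+) :
    wordProd g (a :: w) = g (a : ℕ) * wordProd g w := by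
  rw [wordProd, List.map_cons, List.prod_cons, wordProd]

variable (k g) in
/-- The span of the products of fixed degree indexed by partitions. -/
def sortedSpan (n : ℕ) : Submodule k R :=
  Submodule.span k (wordProd g '' {w | w.Pairwise (· ≥ ·) ∧ size w = n})

theorem wordProd_mem_sortedSpan {w : List ℕ+} (hw : w.Pairwise (· ≥ ·)) :
    wordProd g w ∈ sortedSpan k g (size w) :=
  Submodule.subset_span ⟨w, ⟨hw, rfl⟩, rfl⟩

theorem units_smul_mem {N : Submodule k R} (u : ℤˣ) {x : R} (hx : x ∈ N) : u • x ∈ N := by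
  rw [Units.smul_def]
  exact zsmul_mem hx _

/-- An ascending product of two terms is a combination of descending ones. -/
theorem OddRelations.mul_mul_mem (hg : OddRelations g) {N : Submodule k R} {y : R} (d : ℕ) (c : ℤ)
    (h : ∀ j : ℕ, j ≤ d → g (c + j) * (g ((d : ℤ) - j) * y) ∈ N) : g d * (g c * y) ∈ N := by
  induction d generalizing c with
  | zero => simpa [hg.zero] using h 0 le_rfl
  | succ d ih =>
    have h0 := h 0 (Nat.zero_le _)
    simp only [Nat.cast_zero, add_zero, sub_zero] at h0
    rcases Int.even_or_odd (((d + 1 : ℕ) : ℤ) + c) with hp | hp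
    · rwa [← mul_assoc, hg.even _ _ hp, mul_assoc]
    · have h1 := h 1 (by omega)
      have h2 := ih (c + 1) fun j hj => by
        have := h (j + 1) (by omega)
        push_cast at this
        rwa [← add_assoc, add_right_comm, add_sub_add_right_eq_sub] at this
      -- The odd relation for `(c, d + 1)` expresses `g (d + 1) * g c` through two products covered
      -- by `h` and the product `g d * g (c + 1)`, which is covered by the induction on `d`.
      have key := congrArg (· * y) (hg.odd c ((d + 1 : ℕ) : ℤ) (by rwa [add_comm]))
      simp only [add_mul, smul_mul_assoc, mul_assoc] at key
      push_cast at key h0 h1 h2 ⊢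
      rw [add_sub_cancel_right] at key h1
      have e : c.negOnePow • (g (d + 1) * (g c * y)) ∈ N := by
        rw [eq_sub_of_add_eq' key]
        exact sub_mem (add_mem (units_smul_mem _ h1) h2) h0
      have := units_smul_mem c.negOnePow e
      rwa [smul_smul, ← Int.negOnePow_add, Int.negOnePow_even _ ⟨c, rfl⟩, one_smul] at this

/-- The induction is on a bound `i` for the degree `m` of the tail. If `a` is smaller than the
leading letter `b` of the tail, then `g a * g b` is traded for products `g (b + j) * g (a - j)`. The
new tail is re-sorted by `ih` and has smaller degree, since `a - j < b`. -/
theorem OddRelations.mul_mem_sortedSpan (hg : OddRelations g) {n : ℕ}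
    (ih : ∀ w : List ℕ+, size w < n → wordProd g w ∈ sortedSpan k g (size w)) (i : ℕ) :
    ∀ (a : ℕ+) (m : ℕ), a + m = n → m ≤ i → ∀ y ∈ sortedSpan k g m,
      g (a : ℕ) * y ∈ sortedSpan k g n := by
  induction i with
  | zero =>
    intro a m ham hm y hy
    obtain rfl : m = 0 := by omega
    refine Submodule.span_induction (p := fun y _ => g (a : ℕ) * y ∈ sortedSpan k g n) ?_ ?_ ?_ ?_ hy
    · rintro _ ⟨w, ⟨-, hw⟩, rfl⟩
      rcases w with _ | ⟨b, w⟩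
      · have := wordProd_mem_sortedSpan (k := k) (g := g) (List.pairwise_singleton (· ≥ ·) a)
        rw [wordProd_cons, size_cons, hw, ham] at this
        exact this
      · rw [size_cons] at hw
        exact absurd b.pos (by omega)
    · simp
    · intro x y _ _ hx hy
      rw [mul_add]
      exact add_mem hx hy
    · intro c x _ hx
      rw [mul_smul_comm]
      exact Submodule.smul_mem _ _ hx
  | succ i ihi =>
    intro a m ham hm y hy
    refine Submodule.span_induction (p := fun y _ => g (a : ℕ) * y ∈ sortedSpan k g n) ?_ ?_ ?_ ?_ hy
    · rintro _ ⟨w, ⟨hsw, hw⟩, rfl⟩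
      rcases w with _ | ⟨b, w⟩
      · have := wordProd_mem_sortedSpan (k := k) (g := g) (List.pairwise_singleton (· ≥ ·) a)
        rw [wordProd_cons, size_cons, hw, ham] at this
        exact this
      · rcases le_or_gt b a with hba | hab
        · rw [← ham, ← hw, ← size_cons, ← wordProd_cons]
          refine wordProd_mem_sortedSpan (List.pairwise_cons.mpr ⟨fun x hx => ?_, hsw⟩)
          rcases List.mem_cons.mp hx with rfl | hx
          · exact hba
          · exact le_trans ((List.pairwise_cons.mp hsw).1 x hx) hba
        · rw [wordProd_cons]
          rw [size_cons] at hw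
          have hab' : (a : ℕ) < b := by exact_mod_cast hab
          refine hg.mul_mul_mem (a : ℕ) _ fun j hj => ?_
          have hy : g (((a : ℕ) : ℤ) - j) * wordProd g w ∈ sortedSpan k g (a - j + size w) := by
            rcases hj.eq_or_lt with rfl | hj
            · rw [sub_self, hg.zero, one_mul, Nat.sub_self, zero_add]
              exact ih w (by omega)
            · obtain ⟨e, he⟩ : ∃ e : ℕ+, (e : ℕ) = a - j := ⟨⟨a - j, by omega⟩, rfl⟩
              have := ih (e :: w) (by
                rw [size_cons, he]
                have := b.pos
                omega)
              rwa [wordProd_cons, size_cons, he, Nat.cast_sub hj.le] at this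
          obtain ⟨e, he⟩ : ∃ e : ℕ+, (e : ℕ) = b + j := ⟨⟨b + j, Nat.add_pos_left b.pos j⟩, rfl⟩
          have := ihi e (a - j + size w) (by rw [he]; omega) (by omega) _ hy
          rwa [he, Nat.cast_add] at this
    · simp
    · intro x y _ _ hx hy
      rw [mul_add]
      exact add_mem hx hy
    · intro c x _ hx
      rw [mul_smul_comm]
      exact Submodule.smul_mem _ _ hx

theorem OddRelations.wordProd_mem_sortedSpan (hg : OddRelations g) (w : List ℕ+) :
    wordProd g w ∈ sortedSpan k g (size w) := by
  induction hn : size w using Nat.strong_induction_on generalizing w with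
  | _ n ih =>
    subst hn
    rcases w with _ | ⟨a, w⟩
    · exact OddSym.wordProd_mem_sortedSpan List.Pairwise.nil
    · rw [wordProd_cons]
      refine hg.mul_mem_sortedSpan (fun w' h => ih _ h w' rfl) (size w) a (size w)
        (size_cons a w).symm le_rfl _ (ih (size w) ?_ w rfl)
      rw [size_cons]
      have := a.pos
      omega

end Spanning

/-! ### The radical equals the ideal of relations -/

section Radical

variable {k : Type*} [CommRing k]

theorem sub_mem_radical {x y : Free k} (hx : x ∈ radical k (-1)) (hy : y ∈ radical k (-1)) :
    x - y ∈ radical k (-1) := fun z => by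
  rw [map_sub, LinearMap.sub_apply, hx z, hy z, sub_zero]

theorem add_mem_radical {x y : Free k} (hx : x ∈ radical k (-1)) (hy : y ∈ radical k (-1)) :
    x + y ∈ radical k (-1) := fun z => by
  rw [map_add, LinearMap.add_apply, hx z, hy z, add_zero]

theorem exists_sub_linearCombination_mem_relIdeal (x : Free k) :
    ∃ c : List ℕ+ →₀ k, (∀ l ∈ c.support, l.Pairwise (· ≥ ·)) ∧
      x - Finsupp.linearCombination k (fun l : List ℕ+ => (l.map (FreeAlgebra.ι k)).prod) c ∈
        relIdeal k := by
  let f := RingCon.mkₐ k (relIdeal k).ringCon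
  have hg : OddRelations fun n => f (freeH k n) := oddRelations_mk_of_relIdeal_le le_rfl
  have hw : ∀ w : List ℕ+, f ((w.map (FreeAlgebra.ι k)).prod) =
      wordProd (fun n => f (freeH k n)) w := fun w => by
    rw [map_list_prod, List.map_map, wordProd]
    congr 1
    refine List.map_congr_left fun a _ => ?_
    rw [Function.comp, freeH_coe]
  have hx : f x ∈ Submodule.span k
      ((fun l : List ℕ+ => f ((l.map (FreeAlgebra.ι k)).prod)) '' {l | l.Pairwise (· ≥ ·)}) := by
    rw [← (FreeAlgebra.basisFreeMonoid k ℕ+).linearCombination_repr x,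
      Finsupp.linearCombination_apply, Finsupp.sum, map_sum]
    refine Submodule.sum_mem _ fun w _ => ?_
    obtain ⟨w, rfl⟩ := FreeMonoid.ofList.surjective w
    rw [map_smul, basisFreeMonoid_ofList, hw]
    refine Submodule.smul_mem _ _ ?_
    refine Submodule.span_mono ?_ (hg.wordProd_mem_sortedSpan w)
    rintro _ ⟨l, ⟨hl, -⟩, rfl⟩
    exact ⟨l, hl, hw l⟩
  obtain ⟨c, hc, hcx⟩ := (Finsupp.mem_span_image_iff_linearCombination k).mp hx
  refine ⟨c, fun l hl => hc hl, ?_⟩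
  rw [← mkₐ_eq_zero_iff, map_sub, sub_eq_zero]
  refine hcx.symm.trans ?_
  exact (Finsupp.apply_linearCombination k f.toLinearMap _ c).symm

theorem mem_radical_iff_mem_relIdeal (x : Free k) :
    x ∈ radical k (-1) ↔ x ∈ relIdeal k := by
  refine ⟨fun h => ?_, mem_radical_of_mem_relIdeal⟩
  obtain ⟨c, hc, hx⟩ := exists_sub_linearCombination_mem_relIdeal x
  have h0 := sub_mem_radical h (mem_radical_of_mem_relIdeal hx)
  rw [sub_sub_cancel] at h0
  rw [eq_zero_of_linearCombination_mem_radical hc h0, map_zero, sub_zero] at hx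
  exact hx

theorem span_radical : TwoSidedIdeal.span (radical k (-1)) = relIdeal k := by
  refine le_antisymm (TwoSidedIdeal.span_le.mpr fun x hx => ?_) fun x hx => ?_
  · exact (mem_radical_iff_mem_relIdeal x).mp hx
  · exact TwoSidedIdeal.subset_span ((mem_radical_iff_mem_relIdeal x).mpr hx)

theorem toLam_eq_zero_iff (x : Free k) : toLam k (-1) x = 0 ↔ x ∈ radical k (-1) := by
  rw [toLam, mkₐ_eq_zero_iff, span_radical, mem_radical_iff_mem_relIdeal]

theorem exists_algEquiv_of_eq {I J : TwoSidedIdeal (Free k)} (h : I = J) :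
    ∃ Φ : I.ringCon.Quotient ≃ₐ[k] J.ringCon.Quotient,
      ∀ x, Φ (RingCon.mkₐ k I.ringCon x) = RingCon.mkₐ k J.ringCon x := by
  subst h
  exact ⟨AlgEquiv.refl, fun _ => rfl⟩

theorem exists_presented_algEquiv :
    ∃ Φ : Presented k ≃ₐ[k] Lam k (-1), ∀ n : ℤ, Φ (presentedH k n) = oddH k n := by
  obtain ⟨Φ, h⟩ := exists_algEquiv_of_eq (span_radical (k := k)).symm
  exact ⟨Φ, fun n => h _⟩

end Radical

end OddSym

namespace OddSym

/-! ### The elementary functions satisfy the same relations -/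

section ElementaryRelations

variable {k : Type*} [CommRing k]

theorem units_smul_mem_radical (u : ℤˣ) {x : Free k} (hx : x ∈ radical k (-1)) :
    u • x ∈ radical k (-1) := fun y => by
  rw [Units.smul_def, map_zsmul, LinearMap.smul_apply, hx y, smul_zero]

theorem zero_mem_radical : (0 : Free k) ∈ radical k (-1) := fun y => by
  rw [map_zero, LinearMap.zero_apply]

theorem skew_one_freeE_mul_freeE (c d : ℤ) :
    skew k 1 (freeE k c * freeE k d) = (c + d).negOnePow • (freeE k c * freeE k (d - 1)) +
      c.negOnePow • (freeE k (c - 1) * freeE k d) := by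
  rw [show 1 = 0 + 1 from rfl, skew_succ_freeE_mul, (skew_freeE d).1, skew_zero, mul_smul_comm,
    smul_smul, ← Int.negOnePow_add]
  simp

theorem skew_two_freeE_mul_freeE (c d : ℤ) :
    skew k 2 (freeE k c * freeE k d) = (d + 1).negOnePow • (freeE k (c - 1) * freeE k (d - 1)) := by
  rw [show 2 = 1 + 1 from rfl, skew_succ_freeE_mul, (skew_freeE d).2 0, (skew_freeE d).1,
    mul_smul_comm, smul_smul, ← Int.negOnePow_add, mul_zero, smul_zero, zero_add]
  congr 1
  rw [Int.negOnePow_eq_iff]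
  simp only [Int.even_sub, Int.even_add, Int.even_mul, Int.not_even_one]
  tauto

theorem skew_add_three_freeE_mul_freeE (b : ℕ) (c d : ℤ) :
    skew k (b + 3) (freeE k c * freeE k d) = 0 := by
  rw [show b + 3 = (b + 2) + 1 from rfl, skew_succ_freeE_mul, (skew_freeE d).2 b,
    (skew_freeE d).2 (b + 1), mul_zero, mul_zero, smul_zero, smul_zero, add_zero]

theorem counit_freeE (n : ℤ) : counit k (freeE k n) = if n = 0 then 1 else 0 := by
  rcases lt_or_ge n 0 with hn | hn
  · rw [freeE, convInvInt_neg _ hn, map_zero, if_neg hn.ne]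
  lift n to ℕ using hn
  rw [freeE, convInvInt_natCast]
  induction n using Nat.strong_induction_on with
  | _ n ih =>
    rcases n with _ | n
    · simp [convInv]
    · rw [convInv_succ, map_neg, map_sum, Finset.sum_eq_zero, neg_zero, if_neg (by positivity)]
      intro j hj
      rw [map_mul, counit_freeH, if_neg (by have := Finset.mem_range.mp hj; omega), mul_zero]

variable (k) in
/-- The commutator of two elementary functions. -/
noncomputable def evenRelE (c d : ℤ) : Free k := freeE k c * freeE k d - freeE k d * freeE k c

variable (k) in
/-- The second kind of defining relation, in elementary functions. -/
noncomputable def oddRelE (a b : ℤ) : Free k :=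
  (freeE k a * freeE k b + a.negOnePow • (freeE k b * freeE k a)) -
    (a.negOnePow • (freeE k (a + 1) * freeE k (b - 1)) + freeE k (b - 1) * freeE k (a + 1))

theorem mem_radical_of_skew_one_two {x : Free k} (h0 : counit k x = 0)
    (h1 : skew k 1 x ∈ radical k (-1)) (h2 : skew k 2 x ∈ radical k (-1))
    (h3 : ∀ b, skew k (b + 3) x = 0) : x ∈ radical k (-1) := by
  refine mem_radical_of_skew h0 fun a ha => ?_
  match a, ha with
  | 1, _ => exact h1
  | 2, _ => exact h2
  | b + 3, _ => rw [h3]; exact zero_mem_radical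

theorem skew_one_evenRelE {c d : ℤ} (h : Even (c + d)) :
    skew k 1 (evenRelE k c d) = c.negOnePow • oddRelE k (c - 1) d := by
  rw [evenRelE, oddRelE, map_sub, skew_one_freeE_mul_freeE, skew_one_freeE_mul_freeE,
    add_comm d c, Int.negOnePow_even _ h, sub_add_cancel]
  rcases Int.even_or_odd c with hc | hc
  · rw [Int.negOnePow_even _ hc, Int.negOnePow_even d ((Int.even_add.mp h).mp hc),
      Int.negOnePow_odd _ (hc.sub_odd odd_one)]
    simp only [one_smul, Units.neg_smul]
    abel
  · rw [Int.negOnePow_odd _ hc, Int.negOnePow_odd d ((Int.even_add'.mp h).mp hc),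
      Int.negOnePow_even _ (hc.sub_odd odd_one)]
    simp only [one_smul, Units.neg_smul]
    abel

theorem skew_two_evenRelE {c d : ℤ} (h : Even (c + d)) :
    skew k 2 (evenRelE k c d) = (d + 1).negOnePow • evenRelE k (c - 1) (d - 1) := by
  have e : (c + 1).negOnePow = (d + 1).negOnePow := by
    rw [Int.negOnePow_eq_iff, add_sub_add_right_eq_sub]
    exact Int.even_sub.mpr (Int.even_add.mp h)
  rw [evenRelE, evenRelE, map_sub, skew_two_freeE_mul_freeE, skew_two_freeE_mul_freeE, e, smul_sub]

theorem skew_one_oddRelE {c d : ℤ} (h : Odd (c + d)) :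
    skew k 1 (oddRelE k c d) =
      c.negOnePow • (evenRelE k (c - 1) d + evenRelE k (c + 1) (d - 2)) := by
  simp only [evenRelE, oddRelE, map_sub, map_add, Units.smul_def, map_zsmul]
  simp only [← Units.smul_def, skew_one_freeE_mul_freeE, add_sub_cancel_right,
    show d - 1 - 1 = d - 2 by ring, show c + 1 + (d - 1) = c + d by ring,
    show d - 1 + (c + 1) = c + d by ring, add_comm d c, Int.negOnePow_odd _ h]
  rcases Int.even_or_odd c with hc | hc
  · have hd : Odd d := (Int.odd_add'.mp h).mpr hc
    rw [Int.negOnePow_even _ hc, Int.negOnePow_odd d hd, Int.negOnePow_odd _ hc.add_one,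
      Int.negOnePow_even _ (hd.sub_odd odd_one)]
    simp only [one_smul, Units.neg_smul]
    abel
  · have hd : Even d := (Int.odd_add.mp h).mp hc
    rw [Int.negOnePow_odd _ hc, Int.negOnePow_even d hd, Int.negOnePow_even _ hc.add_one,
      Int.negOnePow_odd _ (hd.sub_odd odd_one)]
    simp only [one_smul, Units.neg_smul]
    abel

theorem skew_two_oddRelE {c d : ℤ} (h : Odd (c + d)) :
    skew k 2 (oddRelE k c d) = c.negOnePow • oddRelE k (c - 1) (d - 1) := by
  simp only [oddRelE, map_sub, map_add, Units.smul_def, map_zsmul]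
  simp only [← Units.smul_def, skew_two_freeE_mul_freeE, add_sub_cancel_right, sub_add_cancel]
  rcases Int.even_or_odd c with hc | hc
  · have hd : Odd d := (Int.odd_add'.mp h).mpr hc
    rw [Int.negOnePow_even _ hc, Int.negOnePow_odd d hd, Int.negOnePow_odd _ hc.add_one,
      Int.negOnePow_even _ hd.add_one, Int.negOnePow_even _ hc.add_one.add_one,
      Int.negOnePow_odd _ (hc.sub_odd odd_one)]
    simp only [one_smul, Units.neg_smul]
  · have hd : Even d := (Int.odd_add.mp h).mp hc
    rw [Int.negOnePow_odd _ hc, Int.negOnePow_even d hd, Int.negOnePow_even _ hc.add_one,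
      Int.negOnePow_odd _ hd.add_one, Int.negOnePow_odd _ hc.add_one.add_one,
      Int.negOnePow_even _ (hc.sub_odd odd_one)]
    simp only [one_smul, Units.neg_smul]
    abel

/-- Induction on the degree `c + d`. Skewing by one exchanges the two kinds of relator, skewing by
two preserves the kind, both in lower degree and up to signs and sums; higher skewings vanish and so
does the counit. In negative degree every product contains a factor of negative index. -/
theorem relE_mem_radical (N : ℕ) : ∀ c d : ℤ, c + d < N →
    (Even (c + d) → evenRelE k c d ∈ radical k (-1)) ∧
      (Odd (c + d) → oddRelE k c d ∈ radical k (-1)) := by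
  induction N with
  | zero =>
    intro c d hcd
    have h : ∀ c d : ℤ, c + d < 0 → freeE k c * freeE k d = 0 := fun c d h => by
      rcases lt_or_ge c 0 with hc | hc
      · rw [freeE, convInvInt_neg _ hc, zero_mul]
      · rw [freeE, freeE, convInvInt_neg _ (show d < 0 by omega), mul_zero]
    rw [Nat.cast_zero] at hcd
    rw [evenRelE, oddRelE, h c d hcd, h d c (by omega), h (c + 1) (d - 1) (by omega),
      h (d - 1) (c + 1) (by omega)]
    simp [zero_mem_radical]
  | succ N ih =>
    intro c d hcd
    rw [Nat.cast_succ] at hcd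
    refine ⟨fun h => mem_radical_of_skew_one_two ?_ ?_ ?_ fun b => ?_,
      fun h => mem_radical_of_skew_one_two ?_ ?_ ?_ fun b => ?_⟩
    · rw [evenRelE, map_sub, map_mul, map_mul, mul_comm, sub_self]
    · rw [skew_one_evenRelE h]
      refine units_smul_mem_radical _ ((ih (c - 1) d (by omega)).2 ?_)
      rw [sub_add_eq_add_sub]
      exact h.sub_odd odd_one
    · rw [skew_two_evenRelE h]
      refine units_smul_mem_radical _ ((ih (c - 1) (d - 1) (by omega)).1 ?_)
      rw [show c - 1 + (d - 1) = c + d - 2 by ring]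
      exact h.sub even_two
    · simp only [evenRelE, map_sub, skew_add_three_freeE_mul_freeE, sub_zero]
    · have h' : ∀ a b : ℤ, Odd (a + b) → counit k (freeE k a * freeE k b) = 0 := fun a b hab => by
        rw [map_mul, counit_freeE, counit_freeE]
        split_ifs with ha hb <;> simp_all
      simp only [oddRelE, map_sub, map_add, Units.smul_def, map_zsmul]
      rw [h' c d h, h' d c (by rwa [add_comm]), h' (c + 1) (d - 1) (by rwa [add_add_sub_cancel]),
        h' (d - 1) (c + 1) (by rwa [add_comm, add_add_sub_cancel])]
      simp
    · rw [skew_one_oddRelE h]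
      refine units_smul_mem_radical _ (add_mem_radical ((ih (c - 1) d (by omega)).1 ?_)
        ((ih (c + 1) (d - 2) (by omega)).1 ?_))
      · rw [sub_add_eq_add_sub]
        exact h.sub_odd odd_one
      · rw [show c + 1 + (d - 2) = c + d - 1 by ring]
        exact h.sub_odd odd_one
    · rw [skew_two_oddRelE h]
      refine units_smul_mem_radical _ ((ih (c - 1) (d - 1) (by omega)).2 ?_)
      rw [show c - 1 + (d - 1) = c + d - 2 by ring]
      exact h.sub_even even_two
    · simp only [oddRelE, map_sub, map_add, Units.smul_def, map_zsmul,
        skew_add_three_freeE_mul_freeE, smul_zero, sub_zero, add_zero]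

theorem oddRelations_toLam_freeE : OddRelations fun n => toLam k (-1) (freeE k n) where
  zero := by rw [freeE_zero, map_one]
  neg n hn := by rw [freeE, convInvInt_neg _ hn, map_zero]
  even a b h := by
    have := (toLam_eq_zero_iff (k := k) _).mpr
      ((relE_mem_radical ((a + b).toNat + 1) a b (by omega)).1 h)
    rwa [evenRelE, map_sub, map_mul, map_mul, sub_eq_zero] at this
  odd a b h := by
    have := (toLam_eq_zero_iff (k := k) _).mpr
      ((relE_mem_radical ((a + b).toNat + 1) a b (by omega)).2 h)
    rw [oddRelE, map_sub, sub_eq_zero] at this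
    simpa only [map_add, map_mul, Units.smul_def, map_zsmul] using this

end ElementaryRelations

/-! ### The automorphism and its inverse -/

section Automorphism

variable {k : Type*} [CommRing k]

theorem oddRelations_oddH : OddRelations (oddH k) :=
  oddRelations_mk_of_relIdeal_le span_radical.ge

theorem free_hom_ext {R : Type*} [Ring R] [Algebra k R] {f g : Free k →ₐ[k] R}
    (h : ∀ n : ℕ, f (freeH k n) = g (freeH k n)) : f = g := by
  refine FreeAlgebra.hom_ext (funext fun a => ?_)
  rw [Function.comp, Function.comp, ← freeH_coe]
  exact h a

/-- The universal property of the algebra of odd symmetric functions. -/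
theorem exists_lift {R : Type*} [Ring R] [Algebra k R] {g : ℤ → R} (hg : OddRelations g) :
    ∃ f : Lam k (-1) →ₐ[k] R, ∀ n, f (oddH k n) = g n := by
  let F : Free k →ₐ[k] R := FreeAlgebra.lift k fun a => g (a : ℕ)
  have hF : ∀ n, F (freeH k n) = g n := fun n => by
    rcases lt_trichotomy n 0 with hn | rfl | hn
    · rw [freeH_neg k hn, map_zero, hg.neg n hn]
    · rw [freeH_zero, map_one, hg.zero]
    · obtain ⟨a, rfl⟩ := exists_pnat_of_pos hn
      rw [freeH_coe]
      exact FreeAlgebra.lift_ι_apply _ _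
  have hker : (TwoSidedIdeal.span (radical k (-1))).ringCon ≤ RingCon.ker F.toRingHom := by
    intro x y hxy
    rw [TwoSidedIdeal.rel_iff, span_radical] at hxy
    have := relIdeal_le_ker F (by simpa only [hF] using hg) hxy
    rw [map_sub, sub_eq_zero] at this
    exact this
  exact ⟨RingCon.liftₐ _ F hker, fun n => hF n⟩

theorem lam_hom_ext {R : Type*} [Ring R] [Algebra k R] {f g : Lam k (-1) →ₐ[k] R}
    (h : ∀ n : ℕ, f (oddH k n) = g (oddH k n)) : f = g := by
  have : f.comp (toLam k (-1)) = g.comp (toLam k (-1)) := free_hom_ext h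
  refine AlgHom.ext fun x => ?_
  obtain ⟨x, rfl⟩ := RingCon.mkₐ_surjective (α := k) _ x
  exact DFunLike.congr_fun this x

theorem toLam_freeE (n : ℕ) : toLam k (-1) (freeE k n) = convInv (oddH k) n := by
  rw [freeE, convInvInt_natCast]
  exact map_convInv (toLam k (-1)).toRingHom (freeH k) n

/-- A sequence is determined by its left convolution with a sequence starting with `1`. -/
theorem eq_of_sum_mul_eq_zero {R : Type*} [Ring R] {u v : ℕ → R} {g : ℤ → R} (hg : g 0 = 1)
    (h0 : u 0 = v 0) (hu : ∀ n : ℕ, n ≠ 0 → ∑ j ∈ Finset.range (n + 1), u j * g ((n : ℤ) - j) = 0)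
    (hv : ∀ n : ℕ, n ≠ 0 → ∑ j ∈ Finset.range (n + 1), v j * g ((n : ℤ) - j) = 0) (n : ℕ) :
    u n = v n := by
  induction n using Nat.strong_induction_on with
  | _ n ih =>
    rcases eq_or_ne n 0 with rfl | hn
    · exact h0
    · have h := (hu n hn).trans (hv n hn).symm
      rw [Finset.sum_range_succ, Finset.sum_range_succ, sub_self, hg, mul_one, mul_one,
        Finset.sum_congr rfl fun j hj => by rw [ih j (Finset.mem_range.mp hj)]] at h
      exact add_left_cancel h

theorem eq_of_sum_mul_eq_zero' {R : Type*} [Ring R] {u v : ℕ → R} {g : ℤ → R} (hg : g 0 = 1)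
    (h0 : u 0 = v 0) (hu : ∀ n : ℕ, n ≠ 0 → ∑ j ∈ Finset.range (n + 1), g ((n : ℤ) - j) * u j = 0)
    (hv : ∀ n : ℕ, n ≠ 0 → ∑ j ∈ Finset.range (n + 1), g ((n : ℤ) - j) * v j = 0) (n : ℕ) :
    u n = v n := by
  refine MulOpposite.op_injective (eq_of_sum_mul_eq_zero (u := fun j => MulOpposite.op (u j))
    (v := fun j => MulOpposite.op (v j)) (g := fun j => MulOpposite.op (g j)) (by rw [hg]; rfl)
    (congrArg _ h0) (fun n hn => ?_) (fun n hn => ?_) n)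
  · simpa using congrArg MulOpposite.op (hu n hn)
  · simpa using congrArg MulOpposite.op (hv n hn)

theorem sum_range_sub_comm {R : Type*} [Ring R] (F : ℤ → ℤ → R) (n : ℕ) :
    ∑ j ∈ Finset.range (n + 1), F j ((n : ℤ) - j) = ∑ j ∈ Finset.range (n + 1), F ((n : ℤ) - j) j := by
  rw [← Finset.sum_flip]
  refine Finset.sum_congr rfl fun j hj => ?_
  rw [Nat.cast_sub (Nat.lt_succ_iff.mp (Finset.mem_range.mp hj)), sub_sub_cancel]

theorem oddH_zero : oddH k 0 = 1 := oddRelations_oddH.zero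

theorem triSign_smul_oddE (n : ℕ) : triSign n • oddE k n = convInv (oddH k) n := by
  refine eq_of_sum_mul_eq_zero (u := fun n : ℕ => triSign n • oddE k n) (v := convInv (oddH k))
    oddH_zero ?_ (fun n hn => ?_) (fun n hn => sum_convInv oddH_zero hn) n
  · rw [oddE, convInv, Nat.cast_zero, triSign_zero, one_smul]
  · refine Eq.trans (Finset.sum_congr rfl fun j _ => ?_) (sum_oddE k n (Nat.one_le_iff_ne_zero.mpr hn))
    rw [Units.smul_def, triSign_natCast, zsmul_eq_mul]
    push_cast
    rfl

theorem triSign_smul_convInv_oddH (n : ℕ) : triSign n • convInv (oddH k) n = oddE k n := by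
  rw [← triSign_smul_oddE, smul_smul, triSign_mul_self, one_smul]

theorem exists_psi : ∃ ψ : Lam k (-1) ≃ₐ[k] Lam k (-1), ∀ n : ℕ, ψ (oddH k n) = oddE k n := by
  let E : ℤ → Lam k (-1) := fun n => toLam k (-1) (freeE k n)
  have hE : OddRelations E := oddRelations_toLam_freeE
  have hEn : ∀ n : ℕ, E n = convInv (oddH k) n := toLam_freeE
  have hEH : ∀ n : ℕ, n ≠ 0 → ∑ j ∈ Finset.range (n + 1), E j * oddH k ((n : ℤ) - j) = 0 := by
    intro n hn
    simp only [hEn]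
    exact sum_convInv oddH_zero hn
  obtain ⟨ψ, hψ⟩ := exists_lift (k := k) hE.triSign_smul
  -- Since the relations survive both reversal and the triangular signs, `ρ` is an anti-homomorphism
  -- `h_n ↦ ± h_n`. The candidate inverse `φ` of `ψ` sends `h_n` to `f n`, the image of `E n` under
  -- `ρ`.
  obtain ⟨ρ, hρ⟩ := exists_lift (k := k) (oddRelations_oddH (k := k)).triSign_smul.op
  let f : ℤ → Lam k (-1) := fun n => (ρ (E n)).unop
  have hf : OddRelations f := (hE.map ρ.toRingHom).unop
  obtain ⟨φ, hφ⟩ := exists_lift (k := k) hf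
  have hHf : ∀ n : ℕ, n ≠ 0 →
      ∑ j ∈ Finset.range (n + 1), (triSign ((n : ℤ) - j) • oddH k ((n : ℤ) - j)) * f j = 0 := by
    intro n hn
    have := congrArg (fun x => (ρ x).unop) (hEH n hn)
    simpa only [map_sum, map_mul, hρ, map_zero, MulOpposite.unop_zero, MulOpposite.unop_mul,
      MulOpposite.unop_op, Finset.unop_sum] using this
  -- Applying `ψ` to `hHf` cancels the signs, so `ψ ∘ f` and `h` are both right convolution inverses
  -- of `E`, which are unique.
  have h1 : ∀ n : ℕ, ψ (f n) = oddH k n := by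
    refine eq_of_sum_mul_eq_zero' (u := fun n : ℕ => ψ (f n)) (v := fun n : ℕ => oddH k n) (g := E)
      hE.zero (by simp [hf.zero, oddH_zero]) (fun n hn => ?_) fun n hn => ?_
    · have := congrArg ψ (hHf n hn)
      simp only [map_sum, map_mul, Units.smul_def, map_zsmul, hψ, map_zero] at this
      simpa only [← Units.smul_def, smul_smul, triSign_mul_self, one_smul] using this
    · rw [← sum_range_sub_comm fun a b => E a * oddH k b]
      exact hEH n hn
  -- Here `φ ∘ E` and the signed `h` are both left convolution inverses of `f`: the first by
  -- applying `φ` to `hEH`, the second by `hHf`.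
  have h2 : ∀ n : ℕ, φ (E n) = triSign n • oddH k n := by
    refine eq_of_sum_mul_eq_zero (u := fun n : ℕ => φ (E n))
      (v := fun n : ℕ => triSign n • oddH k n) (g := f) hf.zero ?_ (fun n hn => ?_) fun n hn => ?_
    · simp [hE.zero, oddH_zero, triSign_zero]
    · simpa only [map_sum, map_mul, hφ, map_zero] using congrArg φ (hEH n hn)
    · rw [sum_range_sub_comm fun a b => (triSign a • oddH k a) * f b]
      exact hHf n hn
  refine ⟨AlgEquiv.ofAlgHom ψ φ (lam_hom_ext fun n => ?_) (lam_hom_ext fun n => ?_), fun n => ?_⟩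
  · rw [AlgHom.comp_apply, hφ, h1, AlgHom.id_apply]
  · rw [AlgHom.comp_apply, hψ, Units.smul_def, map_zsmul, ← Units.smul_def, h2, smul_smul,
      triSign_mul_self, one_smul, AlgHom.id_apply]
  · rw [AlgEquiv.ofAlgHom_apply, hψ, hEn, triSign_smul_convInv_oddH]

end Automorphism

end OddSym

theorem mainTheorem6 (k : Type*) [CommRing k] :
    (∀ x : OddSym.Free k, OddSym.toLam k (-1) x = 0 ↔ x ∈ OddSym.radical k (-1)) ∧
    (∃ Φ : OddSym.Presented k ≃ₐ[k] OddSym.Lam k (-1),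
      ∀ n : ℤ, Φ (OddSym.presentedH k n) = OddSym.oddH k n) ∧
    (∃ ψ₁ : OddSym.Lam k (-1) ≃ₐ[k] OddSym.Lam k (-1),
      ∀ n : ℕ, ψ₁ (OddSym.oddH k n) = OddSym.oddE k n) :=
  ⟨OddSym.toLam_eq_zero_iff, OddSym.exists_presented_algEquiv, OddSym.exists_psi⟩
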